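/- For an irrational number $x=[0,n_1,n_2,\dots]\in(0,1)$ let $$\mathbf J(x)=[0,1_{n_1-1},2,1_{n_2-2},2,1_{n_3-2},2,\dots],$$ where $1_k$ denotes the string $1,1,\dots,1$ of length $k$, where $1_0$ is the empty string, and where the strings $1_{-1}$ (which arise from $n_j=1$, $j\ge 2$) are eliminated one at a time by the rule $[\dots,a,1_{-1},b,\dots]\to[\dots,a+b-1,\dots]$. Let $\mathsf P$ be the collapse map $\mathsf P([0,n_1,n_2,\dots])=[0,n_1-1,n_2-1,\dots]$, in which partial quotients that become $0$ are deleted. Let $F_1=F_2=1$, $F_{n+2}=F_{n+1}+F_n$ be the Fibonacci numbers, and for $i\ge 0$ put $$k(i)=\frac{(-1)^i}{\log 2}\log\Bigl(1+\frac{(-1)^i}{F_{i+2}^2}\Bigr),\qquad m(i)=k(i)-2k(i+1)+k(i+2).$$ The series $\sum_{j\ge 0}m(j)$ converges, with sum $\log(3/2)/\log 2=0.58496\ldots$; for $i\ge 1$ put $$u(i)=\frac{m(i-1)}{\sum_{j=0}^\infty m(j)}.$$ Here the frequency of an event along the positions $1,2,3,\dots$ of a continued fraction expansion is $\lim_{N\to\infty}\frac1N\#\{1\le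 j\le N:\text{ the event occurs at position } j\}$. Let $X$ be a uniformly distributed random variable in $[0,1]$. Then almost surely the following hold. 1. For every $i\ge 0$, the frequency of the block $1_i$ in the continued fraction expansion of $X$ exists and equals $k(i)$. 2. For every $i\ge 0$, the frequency of the strings $a,1_i,b$ with $a,b>1$ in the continued fraction expansion of $X$ (that is, of $1_i$ occurring not as part of a longer string of ones) exists and equals $m(i)$. 3. The numbers $\mathbf J(X)$ and $\mathsf P\mathbf J(X)$ are irrational, and for every integer $i\ge 1$ the frequency of $i$ among the partial quotients of $\mathsf P\mathbf J(X)$ exists and equals $u(i)$. -/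

import Mathlib

open MeasureTheory Filter Topology

noncomputable section

namespace Jimm

/-- `pq x j` is the `(j+1)`-st partial quotient `n_{j+1}` of `x = [n_0, n_1, n_2, …]`
(the integer part `n_0` is not counted). It is `0` when the expansion stops earlier. -/
def pq (x : ℝ) (j : ℕ) : ℕ :=
  ⌊((GenContFract.of x).partDens.get? j).getD 0⌋₊

/-- The list `n_1, …, n_N` of the first `N` partial quotients of `x`. -/
def pqList (x : ℝ) (N : ℕ) : List ℕ := (List.range N).map (pq x)

/-- The value of the finite continued fraction `[0, a_1, …, a_r]`. -/
def evalCF : List ℕ → ℝ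
  | [] => 0
  | a :: l => 1 / ((a : ℝ) + evalCF l)

/-- `jimmTail m [n_2, …, n_N]` reduces the string `m, 1_{n_2-2}, 2, 1_{n_3-2}, 2, …, 1_{n_N-2}, 2`,
from left to right, where `1_k` is a string of `k` ones. If `n_2 = 1` the string begins with
`m, 1_{-1}, 2`, which is replaced by the single entry `m + 2 - 1`. If `n_2 = 2` then
`1_0` is the empty string. -/
def jimmTail : ℕ → List ℕ → List ℕ
  | m, [] => [m]
  | m, n :: l =>
      if n = 1 then jimmTail (m + 2 - 1) l
      else m :: (List.replicate (n - 2) 1 ++ jimmTail 2 l)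

/-- The reduced form of the string `1_{n_1-1}, 2, 1_{n_2-2}, 2, …, 1_{n_N-2}, 2`. -/
def jimmList : List ℕ → List ℕ
  | [] => []
  | n :: l => List.replicate (n - 1) 1 ++ jimmTail 2 l

/-- The involution `J` on the irrational numbers `x = [0, n_1, n_2, …]` of the unit interval:
`J x = [0, 1_{n_1-1}, 2, 1_{n_2-2}, 2, 1_{n_3-2}, 2, …]`, the limit of its reduced finite parts. -/
def J (x : ℝ) : ℝ :=
  limUnder atTop (fun N : ℕ => evalCF (jimmList (pqList x N)))

/-- Subtract `1` from every entry and delete the entries that become `0`. -/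
def collapseList (l : List ℕ) : List ℕ := (l.map (fun n => n - 1)).filter (fun n => n ≠ 0)

/-- The collapse `P` of continued fractions: `P [0, n_1, n_2, …] = [0, n_1 - 1, n_2 - 1, …]`, where
vanishing partial quotients are ignored. -/
def P (y : ℝ) : ℝ :=
  limUnder atTop (fun N : ℕ => evalCF (collapseList (pqList y N)))

open Classical in
/-- The positions `j` at which `S j` holds have frequency `c` among all positions `0, 1, 2, …`. -/
def HasFrequency (S : ℕ → Prop) (c : ℝ) : Prop :=
  Tendsto (fun N : ℕ => (((Finset.range N).filter S).card : ℝ) / (N : ℝ)) atTop (𝓝 c)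

/-- `k(i) = ((-1)^i / log 2) · log (1 + (-1)^i / F_{i+2}^2)`. -/
def k (i : ℕ) : ℝ :=
  (-1 : ℝ) ^ i / Real.log 2 * Real.log (1 + (-1 : ℝ) ^ i / (Nat.fib (i + 2) : ℝ) ^ 2)

/-- `m(i) = k(i) - 2 k(i+1) + k(i+2)`. -/
def m (i : ℕ) : ℝ := k i - 2 * k (i + 1) + k (i + 2)

/-- `u(i) = m(i-1) / ∑_{j ≥ 0} m(j)`, for `i ≥ 1`. -/
def u (i : ℕ) : ℝ := m (i - 1) / ∑' j : ℕ, m j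

/-- The block `1_i` occurs in the expansion of `x` beginning at position `j`. -/
def OnesAt (x : ℝ) (i j : ℕ) : Prop := ∀ t < i, pq x (j + t) = 1

/-- At position `j` the expansion of `x` has a string `a, 1_i, b` with `a, b > 1`: the block `1_i`
occurs there, and not inside a longer string of ones. -/
def MaximalOnesAt (x : ℝ) (i j : ℕ) : Prop :=
  1 < pq x j ∧ OnesAt x i (j + 1) ∧ 1 < pq x (j + i + 1)

end Jimm

end

/-!
The law of large numbers needed here concerns only the blocks `1_i`, and for these it follows from a
second moment estimate; neither the pointwise ergodic theorem nor the ergodicity of the Gauss map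
`x ↦ {1/x}` is used.

*Decay of correlations.* With respect to the Gauss measure `dx / (log 2 * (1 + x))` the transfer
operator of the Gauss map is `f ↦ ∑ₖ pₖ(x) f(1/(k+1+x))`, `pₖ(x) = (1+x)/((k+1+x)(k+2+x))`
(`lintegral_mul_comp_gaussMap`). It exchanges monotone and antitone functions on `[0, 1]`
(`transfer_monotoneOn`), and as `pₖ(1) = 2 pₖ₊₁(0)` it halves their oscillation
(`transfer_one_sub_transfer_zero_le`). Its `i`-th iterate sends the indicator function of the set
where the first `i` partial quotients are `1` to the antitone function
`(1+x)/((Fᵢ x + Fᵢ₊₁)(Fᵢ₊₁ x + Fᵢ₊₂))` (`lintegral_onesBlock_mul_comp`), whose integral is `k i` by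
Cassini's identity (`integral_blockDensity`). Hence the occurrences of `1_i` at two positions have
exponentially small correlation (`abs_correlation_le`), the variance of their number among the
first `N` positions is `O(N)`, and the averages converge almost everywhere (`ae_tendsto_average`).

*Maximal blocks.* The frequency of `a, 1_i, b` with `a, b > 1` is obtained by inclusion and
exclusion (`count_maximalOnesAt`). In particular `m i ≥ 0`, and the series `∑ m i` telescopes to
`k 0 - k 1`, the frequency of the partial quotients greater than `1`.

*The numbers `J x` and `P (J x)`.* The rest is deterministic. When one more partial quotient of `x`
is read, only the last entry of the reduced string can change (`jimmList_map_range`), so that `J x`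
has a definite sequence of partial quotients. Those greater than `1` are in bijection with the
maximal runs of ones, possibly empty, that follow the first digit or a digit greater than `1` of
`x`: a run of length `r` gives the entry `r + 2`, hence the partial quotient `r + 1` of `P (J x)`
(`lastEntry_eq_iff`, `exists_J_eq_and_P_J_eq`). Counting runs up to bounded errors gives
`irrational_J_and_hasFrequency_P_J`. That the limits defining `J` and `P` exist and have the
expected partial quotients is the convergence of continued fractions (`tendsto_evalCF_append`,
`pq_cfValue`).
-/

noncomputable section

namespace Jimm

open scoped ENNReal

/-! ### Partial quotients and the Gauss map -/

/-- The Gauss map `x ↦ {1/x}`, with the value `0` at `0`. -/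
def gaussMap (x : ℝ) : ℝ := Int.fract x⁻¹

lemma pq_zero (x : ℝ) : pq x 0 = ⌊(Int.fract x)⁻¹⌋₊ := by
  unfold pq GenContFract.partDens
  rw [Stream'.Seq.map_get?]
  by_cases h : Int.fract x = 0
  · obtain ⟨a, ha⟩ : ∃ a : ℤ, (a : ℝ) = x := ⟨⌊x⌋, by
      have := Int.floor_add_fract x
      rw [h] at this; linarith⟩
    rw [← ha, GenContFract.of_s_of_int]
    simp
  · have := GenContFract.of_s_head h
    rw [Stream'.Seq.head] at this
    rw [this]
    simp [← Int.floor_toNat]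

lemma pq_succ (x : ℝ) (j : ℕ) : pq x (j + 1) = pq (Int.fract x)⁻¹ j := by
  unfold pq GenContFract.partDens
  rw [Stream'.Seq.map_get?, Stream'.Seq.map_get?, GenContFract.of_s_succ]

lemma pq_fract (x : ℝ) (j : ℕ) : pq (Int.fract x) j = pq x j := by
  cases j <;> simp [pq_zero, pq_succ]

lemma gaussMap_mem (x : ℝ) : gaussMap x ∈ Set.Ico (0 : ℝ) 1 :=
  ⟨Int.fract_nonneg _, Int.fract_lt_one _⟩

lemma iterate_gaussMap_mem {x : ℝ} (hx : x ∈ Set.Ico (0 : ℝ) 1) (j : ℕ) :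
    gaussMap^[j] x ∈ Set.Ico (0 : ℝ) 1 := by
  cases j with
  | zero => exact hx
  | succ j => rw [Function.iterate_succ_apply']; exact gaussMap_mem _

lemma pq_succ_eq_gaussMap {x : ℝ} (hx : x ∈ Set.Ico (0 : ℝ) 1) (j : ℕ) :
    pq x (j + 1) = pq (gaussMap x) j := by
  rw [pq_succ, Int.fract_eq_self.2 hx, gaussMap, pq_fract]

lemma pq_add {x : ℝ} (hx : x ∈ Set.Ico (0 : ℝ) 1) (j t : ℕ) :
    pq x (j + t) = pq (gaussMap^[j] x) t := by
  induction j generalizing x with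
  | zero => simp
  | succ j ih =>
    rw [Function.iterate_succ_apply, ← ih (gaussMap_mem x), ← pq_succ_eq_gaussMap hx]
    congr 1; omega

lemma gaussMap_irrational {x : ℝ} (hx : Irrational x) : Irrational (gaussMap x) := by
  have := hx.inv.sub_intCast ⌊x⁻¹⌋
  exact this

lemma iterate_gaussMap_irrational {x : ℝ} (hx : Irrational x) (j : ℕ) :
    Irrational (gaussMap^[j] x) := by
  induction j with
  | zero => exact hx
  | succ j ih => rw [Function.iterate_succ_apply']; exact gaussMap_irrational ih

lemma one_le_pq {x : ℝ} (hx : Irrational x) (hx' : x ∈ Set.Ico (0 : ℝ) 1) (j : ℕ) :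
    1 ≤ pq x j := by
  have h := pq_add hx' j 0
  have h1 := iterate_gaussMap_mem hx' j
  have h2 := iterate_gaussMap_irrational hx j
  rw [add_zero, pq_zero, Int.fract_eq_self.2 h1] at h
  rw [h, Nat.one_le_floor_iff]
  exact (one_le_inv₀ (lt_of_le_of_ne h1.1 h2.ne_zero.symm)).2 h1.2.le

/-- A real number all of whose partial quotients exist is irrational. -/
lemma irrational_of_one_le_pq {x : ℝ} (h : ∀ j, 1 ≤ pq x j) : Irrational x := by
  rintro ⟨q, hq⟩
  obtain ⟨n, hn⟩ := (GenContFract.terminates_iff_rat x).2 ⟨q, hq.symm⟩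
  have h1 := h n
  unfold pq GenContFract.partDens at h1
  rw [Stream'.Seq.map_get?] at h1
  have h2 : (GenContFract.of x).s.get? n = none := hn
  simp [h2] at h1

/-! ### Values of continued fractions with prescribed partial quotients -/

lemma evalCF_mem {l : List ℕ} (hl : ∀ a ∈ l, 1 ≤ a) : evalCF l ∈ Set.Icc (0 : ℝ) 1 := by
  induction l with
  | nil => simp [evalCF]
  | cons a l ih =>
    obtain ⟨h0, h1⟩ := ih fun b hb => hl b (List.mem_cons_of_mem _ hb)
    have ha : (1 : ℝ) ≤ a := by exact_mod_cast hl a List.mem_cons_self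
    rw [evalCF]
    constructor
    · positivity
    · rw [div_le_one (by linarith)]; linarith

/-- Two finite continued fractions with a common prefix are close: two consecutive steps
`t ↦ 1 / (a + 1 / (b + t))` contract by a factor `1/4`. -/
lemma abs_evalCF_append_sub_le (p : List ℕ) {q q' : List ℕ} (hp : ∀ a ∈ p, 1 ≤ a)
    (hq : ∀ a ∈ q, 1 ≤ a) (hq' : ∀ a ∈ q', 1 ≤ a) :
    |evalCF (p ++ q) - evalCF (p ++ q')| ≤ 2 * (1 / 2 : ℝ) ^ p.length := by
  match p with
  | [] =>
    obtain ⟨h1, h2⟩ := evalCF_mem hq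
    obtain ⟨h3, h4⟩ := evalCF_mem hq'
    simp only [List.nil_append, List.length_nil, pow_zero]
    rw [abs_le]; constructor <;> linarith
  | [a] =>
    have H : ∀ r : List ℕ, (∀ a ∈ r, 1 ≤ a) → evalCF ([a] ++ r) ∈ Set.Icc (0 : ℝ) 1 := by
      intro r hr
      apply evalCF_mem
      intro b hb
      rcases List.mem_append.1 hb with h | h
      exacts [hp b h, hr b h]
    obtain ⟨h1, h2⟩ := H q hq
    obtain ⟨h3, h4⟩ := H q' hq'
    simp only [List.length_singleton, pow_one]
    rw [abs_le]; constructor <;> linarith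
  | a :: b :: p =>
    have hp' : ∀ a ∈ p, 1 ≤ a := fun c hc => hp c (by simp [hc])
    have ih := abs_evalCF_append_sub_le p hp' hq hq'
    have H : ∀ r : List ℕ, (∀ a ∈ r, 1 ≤ a) → 0 ≤ evalCF (p ++ r) := by
      intro r hr
      refine (evalCF_mem ?_).1
      intro b hb
      rcases List.mem_append.1 hb with h | h
      exacts [hp' b h, hr b h]
    have hs := H q hq
    have ht := H q' hq'
    have ha : (1 : ℝ) ≤ a := by exact_mod_cast hp a (by simp)
    have hb : (1 : ℝ) ≤ b := by exact_mod_cast hp b (by simp)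
    simp only [List.cons_append, evalCF, List.length_cons]
    set s := evalCF (p ++ q)
    set t := evalCF (p ++ q')
    have hbs : (1 : ℝ) ≤ b + s := by linarith
    have hbt : (1 : ℝ) ≤ b + t := by linarith
    have hA : (2 : ℝ) ≤ a * (b + s) + 1 := by nlinarith
    have hB : (2 : ℝ) ≤ a * (b + t) + 1 := by nlinarith
    have e : 1 / ((a : ℝ) + 1 / (b + s)) - 1 / (a + 1 / (b + t))
        = (s - t) / ((a * (b + s) + 1) * (a * (b + t) + 1)) := by
      have h1 : (b : ℝ) + s ≠ 0 := by linarith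
      have h2 : (b : ℝ) + t ≠ 0 := by linarith
      have h3 : (a : ℝ) * (b + s) + 1 ≠ 0 := by linarith
      have h4 : (a : ℝ) * (b + t) + 1 ≠ 0 := by linarith
      have e1 : 1 / ((a : ℝ) + 1 / (b + s)) = (b + s) / (a * (b + s) + 1) := by field_simp
      have e2 : 1 / ((a : ℝ) + 1 / (b + t)) = (b + t) / (a * (b + t) + 1) := by field_simp
      rw [e1, e2]
      field_simp
      ring
    have hAB : (4 : ℝ) ≤ (a * (b + s) + 1) * (a * (b + t) + 1) := by nlinarith
    rw [e, abs_div, abs_of_pos (by linarith : (0 : ℝ) < (a * (b + s) + 1) * (a * (b + t) + 1)),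
      div_le_iff₀ (by linarith)]
    have : (0 : ℝ) ≤ (1 / 2) ^ p.length := by positivity
    calc |s - t| ≤ 2 * (1 / 2) ^ p.length := ih
      _ = 2 * (1 / 2) ^ (p.length + 1 + 1) * 4 := by ring
      _ ≤ _ := by gcongr

/-- The value of the infinite continued fraction `[0, b 0, b 1, b 2, …]`. -/
def cfValue (b : ℕ → ℕ) : ℝ := limUnder atTop fun N : ℕ => evalCF ((List.range N).map b)

lemma forall_mem_map_range {b : ℕ → ℕ} (hb : ∀ j, 1 ≤ b j) (N : ℕ) :
    ∀ a ∈ (List.range N).map b, 1 ≤ a := by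
  simp only [List.mem_map]
  rintro _ ⟨j, -, rfl⟩
  exact hb j

lemma tendsto_cfValue {b : ℕ → ℕ} (hb : ∀ j, 1 ≤ b j) :
    Tendsto (fun N : ℕ => evalCF ((List.range N).map b)) atTop (𝓝 (cfValue b)) := by
  have : CauchySeq fun N : ℕ => evalCF ((List.range N).map b) := by
    refine cauchySeq_of_le_geometric (1 / 2) 2 (by norm_num) fun n => ?_
    rw [List.range_succ, List.map_append, Real.dist_eq]
    have := abs_evalCF_append_sub_le ((List.range n).map b) (q := []) (q' := List.map b [n])
      (forall_mem_map_range hb n) (by simp) (by simp [hb])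
    simpa using this
  exact (cauchySeq_tendsto_of_complete this).elim fun x hx => by
    rw [cfValue, hx.limUnder_eq]; exact hx

/-- Finite continued fractions that agree with `b` on longer and longer prefixes converge to the
value of `b`. -/
lemma tendsto_evalCF_append {b : ℕ → ℕ} (hb : ∀ j, 1 ≤ b j) (len : ℕ → ℕ) (q : ℕ → List ℕ)
    (hq : ∀ N, ∀ a ∈ q N, 1 ≤ a) (hlen : Tendsto len atTop atTop) :
    Tendsto (fun N : ℕ => evalCF ((List.range (len N)).map b ++ q N)) atTop (𝓝 (cfValue b)) := by
  have h1 := (tendsto_cfValue hb).comp hlen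
  have h2 : Tendsto (fun N : ℕ => evalCF ((List.range (len N)).map b ++ q N)
      - evalCF ((List.range (len N)).map b)) atTop (𝓝 0) := by
    have h3 : Tendsto (fun N : ℕ => 2 * (1 / 2 : ℝ) ^ len N) atTop (𝓝 (2 * 0)) :=
      ((tendsto_pow_atTop_nhds_zero_of_lt_one (by norm_num) (by norm_num)).comp hlen).const_mul 2
    rw [mul_zero] at h3
    refine squeeze_zero_norm (fun N => ?_) h3
    have := abs_evalCF_append_sub_le ((List.range (len N)).map b) (q := q N) (q' := [])
      (forall_mem_map_range hb _) (hq N) (by simp)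
    simpa using this
  simpa using h2.add h1

lemma cfValue_mem_Icc {b : ℕ → ℕ} (hb : ∀ j, 1 ≤ b j) : cfValue b ∈ Set.Icc (0 : ℝ) 1 :=
  isClosed_Icc.mem_of_tendsto (tendsto_cfValue hb)
    (Eventually.of_forall fun N => evalCF_mem (forall_mem_map_range hb N))

lemma cfValue_eq {b : ℕ → ℕ} (hb : ∀ j, 1 ≤ b j) :
    cfValue b = 1 / (b 0 + cfValue fun j => b (j + 1)) := by
  have h1 := (tendsto_cfValue hb).comp (tendsto_add_atTop_nat 1)
  have hb' : ∀ j, 1 ≤ b (j + 1) := fun j => hb _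
  have h0 : (1 : ℝ) ≤ b 0 := by exact_mod_cast hb 0
  have h2 := ((tendsto_cfValue hb').const_add (b 0 : ℝ)).inv₀
    (by have := (cfValue_mem_Icc hb').1; linarith)
  rw [one_div]
  refine tendsto_nhds_unique h1 (h2.congr fun N => ?_)
  simp only [Function.comp, List.range_succ_eq_map, List.map_cons, evalCF, List.map_map, one_div]
  rfl

lemma cfValue_mem_Ioo {b : ℕ → ℕ} (hb : ∀ j, 1 ≤ b j) : cfValue b ∈ Set.Ioo (0 : ℝ) 1 := by
  have pos : ∀ {b : ℕ → ℕ}, (∀ j, 1 ≤ b j) → 0 < cfValue b := by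
    intro b hb
    have h0 : (1 : ℝ) ≤ b 0 := by exact_mod_cast hb 0
    have := (cfValue_mem_Icc (b := fun j => b (j + 1)) fun j => hb _).1
    rw [cfValue_eq hb]; positivity
  refine ⟨pos hb, ?_⟩
  have h0 : (1 : ℝ) ≤ b 0 := by exact_mod_cast hb 0
  have := pos (b := fun j => b (j + 1)) fun j => hb _
  rw [cfValue_eq hb, div_lt_one (by linarith)]
  linarith

lemma pq_cfValue {b : ℕ → ℕ} (hb : ∀ j, 1 ≤ b j) (j : ℕ) : pq (cfValue b) j = b j := by
  have hm := cfValue_mem_Ioo hb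
  have hb' : ∀ j, 1 ≤ b (j + 1) := fun j => hb _
  have hm' := cfValue_mem_Ioo hb'
  have e : (cfValue b)⁻¹ = (b 0 : ℤ) + cfValue fun j => b (j + 1) := by
    rw [cfValue_eq hb]; simp
  induction j generalizing b with
  | zero =>
    rw [pq_zero, Int.fract_eq_self.2 ⟨hm.1.le, hm.2⟩, e, ← Int.floor_toNat, Int.floor_intCast_add,
      Int.floor_eq_zero_iff.2 ⟨hm'.1.le, hm'.2⟩]
    simp
  | succ j ih =>
    rw [pq_succ_eq_gaussMap ⟨hm.1.le, hm.2⟩, gaussMap, e, Int.fract_intCast_add,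
      Int.fract_eq_self.2 ⟨hm'.1.le, hm'.2⟩]
    have hb'' : ∀ j, 1 ≤ b (j + 1 + 1) := fun j => hb _
    exact ih hb' hm' hb'' (cfValue_mem_Ioo hb'') (by rw [cfValue_eq hb']; simp)

lemma cfValue_irrational {b : ℕ → ℕ} (hb : ∀ j, 1 ≤ b j) : Irrational (cfValue b) :=
  irrational_of_one_le_pq fun j => by rw [pq_cfValue hb]; exact hb j

/-! ### Frequencies -/

lemma hasFrequency_iff {S : ℕ → Prop} [DecidablePred S] {c : ℝ} :
    HasFrequency S c ↔ Tendsto (fun N : ℕ => (Nat.count S N : ℝ) / N) atTop (𝓝 c) := by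
  unfold HasFrequency
  simp only [Nat.count_eq_card_filter_range]
  congr!

/-- A sequence at bounded distance from one with a linear rate has the same linear rate. -/
lemma tendsto_div_of_abs_sub_le {f g : ℕ → ℝ} {c K : ℝ}
    (hg : Tendsto (fun N : ℕ => g N / N) atTop (𝓝 c)) (h : ∀ᶠ N in atTop, |f N - g N| ≤ K) :
    Tendsto (fun N : ℕ => f N / N) atTop (𝓝 c) := by
  have h0 : Tendsto (fun N : ℕ => (f N - g N) / N) atTop (𝓝 0) := by
    refine squeeze_zero_norm' ?_ (tendsto_const_div_atTop_nhds_zero_nat K)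
    filter_upwards [h] with N hN
    rw [Real.norm_eq_abs, abs_div, Nat.abs_cast]
    gcongr
  have := h0.add hg
  rw [zero_add] at this
  refine this.congr fun N => ?_
  ring

open Classical in
lemma count_add_count_not (S : ℕ → Prop) (N : ℕ) :
    Nat.count S N + Nat.count (fun j => ¬ S j) N = N := by
  induction N with
  | zero => simp
  | succ N ih =>
    rw [Nat.count_succ, Nat.count_succ]
    by_cases h : S N <;> simp [h] <;> omega

lemma HasFrequency.not {S : ℕ → Prop} {c : ℝ} (h : HasFrequency S c) :
    HasFrequency (fun j => ¬ S j) (1 - c) := by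
  classical
  rw [hasFrequency_iff] at h ⊢
  have h1 := h.const_sub 1
  refine h1.congr' ?_
  filter_upwards [eventually_gt_atTop 0] with N hN
  have e : (Nat.count S N : ℝ) + Nat.count (fun j => ¬ S j) N = N := by
    exact_mod_cast count_add_count_not S N
  have : (N : ℝ) ≠ 0 := by positivity
  field_simp
  linarith

lemma HasFrequency.frequently {S : ℕ → Prop} {c : ℝ} (h : HasFrequency S c) (hc : 0 < c) :
    ∃ᶠ j in atTop, S j := by
  classical
  intro hS
  obtain ⟨K, hK⟩ := eventually_atTop.1 hS
  rw [hasFrequency_iff] at h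
  have bound : ∀ N, Nat.count S N ≤ K := by
    intro N
    induction N with
    | zero => simp
    | succ N ih =>
      rcases le_or_gt K N with hKN | hKN
      · rw [Nat.count_succ, if_neg (hK N hKN)]; exact ih
      · exact (Nat.count_le (p := S) (n := N + 1)).trans hKN
  have h0 : Tendsto (fun N : ℕ => (Nat.count S N : ℝ) / N) atTop (𝓝 0) := by
    refine tendsto_div_of_abs_sub_le (g := fun _ => 0) (K := K) (by simp) ?_
    refine Eventually.of_forall fun N => ?_
    rw [sub_zero, Nat.abs_cast]
    exact_mod_cast bound N
  exact hc.ne' (tendsto_nhds_unique h h0)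

/-! ### Chains of lists -/

/-- An infinite sequence is assembled from a chain of longer and longer prefixes. -/
lemma exists_seq_of_prefix_chain {L : ℕ → List ℕ} (hL : ∀ N, L N <+: L (N + 1))
    (hlen : Tendsto (fun N => (L N).length) atTop atTop) :
    ∃ b : ℕ → ℕ, (∀ N, L N = (List.range (L N).length).map b) ∧ ∀ j, ∃ N, b j ∈ L N := by
  have hmono : ∀ {N N'}, N ≤ N' → L N <+: L N' := by
    intro N N' h
    induction h with
    | refl => exact List.prefix_rfl
    | step _ ih => exact ih.trans (hL _)
  have hex : ∀ j, ∃ N, j < (L N).length := fun j => (hlen.eventually_gt_atTop j).exists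
  choose φ hφ using hex
  refine ⟨fun j => (L (φ j))[j]'(hφ j), fun N => ?_, fun j => ⟨φ j, List.getElem_mem _⟩⟩
  refine List.ext_getElem (by simp) fun j h1 h2 => ?_
  simp only [List.getElem_map, List.getElem_range]
  rcases le_total N (φ j) with h | h
  · exact (hmono h).getElem h1
  · exact ((hmono h).getElem (hφ j)).symm

lemma eq_map_range_of_isPrefix {c : ℕ → ℕ} {l : List ℕ} {M : ℕ}
    (h : l <+: (List.range M).map c) : l = (List.range l.length).map c := by
  refine List.ext_getElem (by simp) fun j h1 h2 => ?_
  rw [h.getElem h1]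
  simp

lemma map_range_isPrefix (b : ℕ → ℕ) {M N : ℕ} (h : M ≤ N) :
    (List.range M).map b <+: (List.range N).map b := by
  obtain ⟨d, rfl⟩ := Nat.exists_eq_add_of_le h
  rw [List.range_add, List.map_append]
  exact List.prefix_append _ _

lemma list_count_map_range (c : ℕ → ℕ) (i M : ℕ) :
    List.count i ((List.range M).map c) = Nat.count (fun j => c j = i) M := by
  induction M with
  | zero => simp
  | succ M ih =>
    rw [List.range_succ, List.map_append, List.count_append, ih, Nat.count_succ]
    simp [List.count_singleton]

/-! ### The lists of partial quotients of `J x` and `P (J x)` -/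

/-- The last entry of `jimmList [n 0, …, n N]`, the only one that later digits can still change: it
is `2` plus the number of ones at the end of `n 1, …, n N`. -/
def lastEntry (n : ℕ → ℕ) : ℕ → ℕ
  | 0 => 2
  | N + 1 => if n (N + 1) = 1 then lastEntry n N + 1 else 2

/-- The list `jimmList [n 0, …, n N]` without its last entry; it is not changed by later digits. -/
def stablePart (n : ℕ → ℕ) : ℕ → List ℕ
  | 0 => List.replicate (n 0 - 1) 1
  | N + 1 => if n (N + 1) = 1 then stablePart n N else
      stablePart n N ++ lastEntry n N :: List.replicate (n (N + 1) - 2) 1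

/-- The effect of one more digit on a reduced string: a digit `1` raises the last entry, any other
digit makes it final. -/
lemma exists_jimmTail_eq (l : List ℕ) (e₀ : ℕ) : ∃ S e, jimmTail e₀ l = S ++ [e] ∧
    ∀ a, jimmTail e₀ (l ++ [a]) =
      if a = 1 then S ++ [e + 1] else S ++ e :: List.replicate (a - 2) 1 ++ [2] := by
  induction l generalizing e₀ with
  | nil =>
    refine ⟨[], e₀, rfl, fun a => ?_⟩
    simp [jimmTail]
  | cons b l ih =>
    by_cases hb : b = 1
    · obtain ⟨S, e, h1, h2⟩ := ih (e₀ + 2 - 1)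
      exact ⟨S, e, by rw [jimmTail, if_pos hb, h1],
        fun a => by simp only [List.cons_append, jimmTail, hb, if_true, h2]⟩
    · obtain ⟨S, e, h1, h2⟩ := ih 2
      refine ⟨e₀ :: (List.replicate (b - 2) 1 ++ S), e, by simp [jimmTail, hb, h1], fun a => ?_⟩
      simp only [List.cons_append, jimmTail, hb, if_false, h2]
      split_ifs <;> simp

lemma jimmList_map_range (n : ℕ → ℕ) (N : ℕ) :
    jimmList ((List.range (N + 1)).map n) = stablePart n N ++ [lastEntry n N] := by
  induction N with
  | zero => simp [jimmList, jimmTail, stablePart, lastEntry]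
  | succ N ih =>
    rw [List.range_succ, List.map_append]
    rw [List.range_succ_eq_map, List.map_cons] at ih ⊢
    simp only [List.cons_append, jimmList] at ih ⊢
    obtain ⟨S, e, h1, h2⟩ := exists_jimmTail_eq (List.map n (List.map Nat.succ (List.range N))) 2
    rw [h1, ← List.append_assoc] at ih
    obtain ⟨h3, h4⟩ := List.append_inj' ih rfl
    obtain rfl : e = lastEntry n N := by simpa using h4
    have : List.map n [N + 1] = [n (N + 1)] := rfl
    rw [this, h2, stablePart, lastEntry, ← h3]
    split_ifs <;> simp

lemma two_le_lastEntry (n : ℕ → ℕ) (N : ℕ) : 2 ≤ lastEntry n N := by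
  induction N with
  | zero => exact le_rfl
  | succ N ih => rw [lastEntry]; split_ifs <;> omega

lemma stablePart_isPrefix (n : ℕ → ℕ) (N : ℕ) : stablePart n N <+: stablePart n (N + 1) := by
  rw [stablePart]
  split_ifs
  · exact List.prefix_rfl
  · exact List.prefix_append _ _

lemma one_le_of_mem_stablePart (n : ℕ → ℕ) (N : ℕ) : ∀ a ∈ stablePart n N, 1 ≤ a := by
  induction N with
  | zero => simp +contextual [stablePart, List.mem_replicate]
  | succ N ih =>
    rw [stablePart]
    split_ifs
    · exact ih
    · intro a ha
      simp only [List.mem_append, List.mem_cons, List.mem_replicate] at ha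
      rcases ha with h | h | h
      · exact ih a h
      · rw [h]; exact one_le_two.trans (two_le_lastEntry n N)
      · exact h.2.ge

lemma collapseList_append (l l' : List ℕ) :
    collapseList (l ++ l') = collapseList l ++ collapseList l' := by
  simp [collapseList]

lemma collapseList_isPrefix {l l' : List ℕ} (h : l <+: l') :
    collapseList l <+: collapseList l' := by
  obtain ⟨t, rfl⟩ := h
  rw [collapseList_append]
  exact List.prefix_append _ _

lemma length_collapseList_le (l : List ℕ) : (collapseList l).length ≤ l.length := by
  refine (List.length_filter_le _ _).trans ?_
  simp

lemma collapseList_replicate_one (r : ℕ) : collapseList (List.replicate r 1) = [] := by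
  simp [collapseList]

/-- Every digit `n (N + 1) > 1` ends a run of ones, possibly empty, and the length of this run
plus one is appended to the collapsed list. -/
lemma collapseList_stablePart_succ (n : ℕ → ℕ) (N : ℕ) :
    collapseList (stablePart n (N + 1)) = collapseList (stablePart n N) ++
      if n (N + 1) = 1 then [] else [lastEntry n N - 1] := by
  rw [stablePart]
  split_ifs
  · simp
  · have h := two_le_lastEntry n N
    have e : collapseList [lastEntry n N] = [lastEntry n N - 1] := by
      simp [collapseList]; omega
    rw [collapseList_append, ← List.singleton_append, collapseList_append,
      collapseList_replicate_one, e, List.append_nil]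

lemma collapseList_stablePart_zero (n : ℕ → ℕ) : collapseList (stablePart n 0) = [] :=
  collapseList_replicate_one _

lemma one_le_of_mem_collapseList (l : List ℕ) : ∀ a ∈ collapseList l, 1 ≤ a := by
  intro a ha
  simp only [collapseList, List.mem_filter, decide_eq_true_eq] at ha
  omega

/-! ### Counting the partial quotients of `P (J x)` -/

lemma length_collapse_add (n : ℕ → ℕ) (N : ℕ) :
    (collapseList (stablePart n N)).length + (if n 0 ≠ 1 then 1 else 0)
      = Nat.count (fun j => n j ≠ 1) (N + 1) := by
  induction N with
  | zero => simp [collapseList_stablePart_zero, Nat.count_succ]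
  | succ N ih =>
    rw [collapseList_stablePart_succ, List.length_append, Nat.count_succ, ← ih]
    by_cases h : n (N + 1) = 1 <;> simp [h]; omega

lemma length_collapse_succ_le (n : ℕ → ℕ) (N : ℕ) :
    (collapseList (stablePart n (N + 1))).length ≤ (collapseList (stablePart n N)).length + 1 := by
  rw [collapseList_stablePart_succ, List.length_append]
  split_ifs <;> simp

lemma length_collapse_le (n : ℕ → ℕ) (N : ℕ) :
    (collapseList (stablePart n N)).length ≤ N := by
  induction N with
  | zero => simp [collapseList_stablePart_zero]
  | succ N ih => exact (length_collapse_succ_le n N).trans (by omega)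

lemma tendsto_length_collapse {n : ℕ → ℕ} (hn : ∃ᶠ j in atTop, n j ≠ 1) :
    Tendsto (fun N => (collapseList (stablePart n N)).length) atTop atTop := by
  have hm : Monotone fun N => (collapseList (stablePart n N)).length :=
    monotone_nat_of_le_succ fun N => (collapseList_isPrefix (stablePart_isPrefix n N)).length_le
  refine tendsto_atTop_atTop_of_monotone hm fun R => ?_
  induction R with
  | zero => exact ⟨0, Nat.zero_le _⟩
  | succ R ih =>
    obtain ⟨K, hK⟩ := ih
    obtain ⟨N, hN, hN1⟩ := frequently_atTop.1 hn (K + 1)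
    obtain ⟨N, rfl⟩ : ∃ N', N = N' + 1 := ⟨N - 1, by omega⟩
    refine ⟨N + 1, ?_⟩
    have := hm (show K ≤ N by omega)
    simp only at this
    rw [collapseList_stablePart_succ, if_neg hN1, List.length_append, List.length_singleton]
    omega

/-- The list of completed runs has every length. -/
lemma exists_length_collapse_eq {n : ℕ → ℕ} (hn : ∃ᶠ j in atTop, n j ≠ 1) (M : ℕ) :
    ∃ N, (collapseList (stablePart n N)).length = M := by
  classical
  have hex : ∃ N, M ≤ (collapseList (stablePart n N)).length :=
    ((tendsto_length_collapse hn).eventually_ge_atTop M).exists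
  refine ⟨Nat.find hex, le_antisymm ?_ (Nat.find_spec hex)⟩
  rcases h : Nat.find hex with _ | N
  · simp [collapseList_stablePart_zero]
  · have h1 := Nat.find_min hex (m := N) (by omega)
    have h2 := length_collapse_succ_le n N
    omega

/-- The last entry is `r + 2` when exactly the last `r` digits are ones. The run must begin after
position `q + 1 > 0`, as the first digit counts as the start of a run even if it is `1`. -/
lemma lastEntry_eq_iff (n : ℕ → ℕ) (q r : ℕ) :
    lastEntry n (q + 1 + r) = r + 2 ↔ n (q + 1) ≠ 1 ∧ ∀ t < r, n (q + 1 + 1 + t) = 1 := by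
  induction r with
  | zero =>
    have := two_le_lastEntry n q
    simp only [lastEntry]
    split_ifs with h <;> simp [h]; omega
  | succ r ih =>
    rw [← add_assoc, lastEntry]
    have e : q + 1 + r + 1 = q + 1 + 1 + r := by omega
    split_ifs with h
    · rw [show (lastEntry n (q + 1 + r) + 1 = r + 1 + 2) ↔ lastEntry n (q + 1 + r) = r + 2 by omega,
        ih]
      refine and_congr_right fun _ => ⟨fun H t ht => ?_, fun H t ht => H t (by omega)⟩
      rcases Nat.lt_succ_iff_lt_or_eq.1 ht with ht | rfl
      · exact H t ht
      · rw [← e]; exact h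
    · refine ⟨fun H => by omega, fun H => absurd (H.2 r (by omega)) (by rwa [← e])⟩

open Classical in
/-- The entries `r + 1` of the collapsed list correspond to the maximal runs of `r` ones, except for
those that begin near the first digit. -/
lemma count_collapse_add {x : ℝ} (h1 : ∀ j, 1 ≤ pq x j) (r Q : ℕ) :
    (collapseList (stablePart (pq x) (Q + (r + 1)))).count (r + 1)
        + (if MaximalOnesAt x r 0 then 1 else 0)
      = (collapseList (stablePart (pq x) (r + 1))).count (r + 1)
        + Nat.count (fun j => MaximalOnesAt x r j) (Q + 1) := by
  induction Q with
  | zero => simp [Nat.count_succ]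
  | succ Q ih =>
    have e : Q + 1 + (r + 1) = Q + (r + 1) + 1 := by omega
    have h2 := two_le_lastEntry (pq x) (Q + (r + 1))
    have hne : ∀ j, pq x j ≠ 1 ↔ 1 < pq x j := fun j => by have := h1 j; omega
    have h3 := lastEntry_eq_iff (pq x) Q r
    rw [show Q + 1 + r = Q + (r + 1) by omega, hne] at h3
    have key : MaximalOnesAt x r (Q + 1) ↔
        lastEntry (pq x) (Q + (r + 1)) = r + 2 ∧ pq x (Q + (r + 1) + 1) ≠ 1 := by
      rw [h3, hne, MaximalOnesAt, OnesAt, and_assoc,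
        show Q + 1 + r + 1 = Q + (r + 1) + 1 by omega]
    rw [e, collapseList_stablePart_succ, List.count_append, Nat.count_succ,
      ← add_assoc (List.count _ (collapseList (stablePart (pq x) (r + 1)))), ← ih]
    by_cases h : pq x (Q + (r + 1) + 1) = 1
    · simp [h, key]
    · simp only [h, if_false, key, List.count_singleton, beq_iff_eq]
      have e' : (lastEntry (pq x) (Q + (r + 1)) - 1 = r + 1) ↔
        lastEntry (pq x) (Q + (r + 1)) = r + 2 := by omega
      simp only [e', ne_eq, h, not_false_eq_true, and_true]
      omega

lemma tendsto_count_collapse {x f : ℝ} {r : ℕ} (h1 : ∀ j, 1 ≤ pq x j)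
    (hf : HasFrequency (fun j => MaximalOnesAt x r j) f) :
    Tendsto (fun N : ℕ => (((collapseList (stablePart (pq x) N)).count (r + 1) : ℕ) : ℝ) / N)
      atTop (𝓝 f) := by
  classical
  rw [hasFrequency_iff] at hf
  set C := (collapseList (stablePart (pq x) (r + 1))).count (r + 1) with hC
  refine tendsto_div_of_abs_sub_le (K := (C + r + 1 : ℕ)) hf ?_
  filter_upwards [eventually_ge_atTop (r + 1)] with N hN
  obtain ⟨Q, rfl⟩ := Nat.exists_eq_add_of_le' hN
  have e1 := count_collapse_add h1 r Q
  have e2 : Nat.count (fun j => MaximalOnesAt x r j) (Q + (r + 1))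
      = Nat.count (fun j => MaximalOnesAt x r j) (Q + 1)
        + Nat.count (fun j => MaximalOnesAt x r (Q + 1 + j)) r := by
    rw [← Nat.count_add]; congr 1; omega
  have e3 : Nat.count (fun j => MaximalOnesAt x r (Q + 1 + j)) r ≤ r := Nat.count_le _
  rw [abs_le]
  have b1 : (if MaximalOnesAt x r 0 then 1 else 0) ≤ 1 := by split_ifs <;> omega
  rw [← hC] at e1
  constructor
  · rw [neg_le_sub_iff_le_add]; norm_cast; omega
  · rw [sub_le_iff_le_add]; norm_cast; omega

lemma tendsto_length_collapse_div {x s : ℝ} (hs : HasFrequency (fun j => pq x j ≠ 1) s) :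
    Tendsto (fun N : ℕ => (((collapseList (stablePart (pq x) N)).length : ℕ) : ℝ) / N)
      atTop (𝓝 s) := by
  classical
  rw [hasFrequency_iff] at hs
  refine tendsto_div_of_abs_sub_le (K := (1 : ℕ)) hs (Eventually.of_forall fun N => ?_)
  have e1 := length_collapse_add (pq x) N
  have b1 : (if pq x 0 ≠ 1 then 1 else 0) ≤ 1 := by split_ifs <;> omega
  have b2 : (if pq x N ≠ 1 then 1 else 0) ≤ 1 := by split_ifs <;> omega
  rw [Nat.count_succ] at e1
  rw [abs_le]
  constructor
  · rw [neg_le_sub_iff_le_add]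
    exact_mod_cast (show Nat.count (fun j => pq x j ≠ 1) N
      ≤ (collapseList (stablePart (pq x) N)).length + 1 by omega)
  · rw [sub_le_iff_le_add]
    exact_mod_cast (show (collapseList (stablePart (pq x) N)).length
      ≤ 1 + Nat.count (fun j => pq x j ≠ 1) N by omega)

/-- The partial quotients of `J x` and `P (J x)` are the stable entries of the reduced strings and
the lengths of the completed runs of ones, increased by one. -/
lemma exists_J_eq_and_P_J_eq {x : ℝ} (hn : ∃ᶠ j in atTop, pq x j ≠ 1) :
    ∃ b c : ℕ → ℕ, (∀ j, 1 ≤ b j) ∧ (∀ j, 1 ≤ c j) ∧ J x = cfValue b ∧ P (J x) = cfValue c ∧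
      ∀ N, collapseList (stablePart (pq x) N) =
        (List.range (collapseList (stablePart (pq x) N)).length).map c := by
  have hlenc := tendsto_length_collapse hn
  have hlen : Tendsto (fun N => (stablePart (pq x) N).length) atTop atTop :=
    tendsto_atTop_mono (fun N => length_collapseList_le _) hlenc
  obtain ⟨b, hb, hb'⟩ := exists_seq_of_prefix_chain (stablePart_isPrefix (pq x)) hlen
  obtain ⟨c, hc, hc'⟩ := exists_seq_of_prefix_chain
    (fun N => collapseList_isPrefix (stablePart_isPrefix (pq x) N)) hlenc
  have hb1 : ∀ j, 1 ≤ b j := fun j =>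
    (hb' j).elim fun N h => one_le_of_mem_stablePart _ N _ h
  have hc1 : ∀ j, 1 ≤ c j := fun j =>
    (hc' j).elim fun N h => one_le_of_mem_collapseList _ _ h
  have hJ : J x = cfValue b := by
    refine Tendsto.limUnder_eq ?_
    rw [← tendsto_add_atTop_iff_nat 1]
    refine (tendsto_evalCF_append hb1 _ (fun N => [lastEntry (pq x) N]) ?_ hlen).congr fun N => ?_
    · intro N a ha
      rw [List.mem_singleton.1 ha]
      exact one_le_two.trans (two_le_lastEntry _ N)
    · rw [← hb N, pqList, jimmList_map_range]
  refine ⟨b, c, hb1, hc1, hJ, ?_, hc⟩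
  have hpq : ∀ N, pqList (J x) N = (List.range N).map b := by
    intro N
    rw [pqList, hJ]
    exact List.map_congr_left fun j _ => pq_cfValue hb1 j
  have hpre : ∀ N, collapseList (pqList (J x) N) =
      (List.range (collapseList (pqList (J x) N)).length).map c := by
    intro N
    obtain ⟨K, hK⟩ := (hlen.eventually_ge_atTop N).exists
    have h1 : pqList (J x) N <+: stablePart (pq x) K := by
      rw [hpq, hb K]; exact map_range_isPrefix b hK
    have h2 := collapseList_isPrefix h1
    rw [hc K] at h2
    exact eq_map_range_of_isPrefix h2
  have hlen' : Tendsto (fun N => (collapseList (pqList (J x) N)).length) atTop atTop := by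
    refine tendsto_atTop.2 fun R => ?_
    obtain ⟨K, hK⟩ := (hlenc.eventually_ge_atTop R).exists
    filter_upwards [eventually_ge_atTop (stablePart (pq x) K).length] with N hN
    have h1 : stablePart (pq x) K <+: pqList (J x) N := by
      rw [hpq, hb K]; exact map_range_isPrefix b (by simpa using hN)
    exact hK.trans (collapseList_isPrefix h1).length_le
  refine Tendsto.limUnder_eq ?_
  refine (tendsto_evalCF_append hc1 _ (fun _ => []) (by simp) hlen').congr fun N => ?_
  rw [← hpre N, List.append_nil]

/-- If the digits other than `1` have a positive frequency `s` in the expansion of `x`, then the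
frequency of `r + 1` in that of `P (J x)` is the frequency of the maximal runs of `r` ones,
normalised by `s`. -/
theorem irrational_J_and_hasFrequency_P_J {x s : ℝ} (h1 : ∀ j, 1 ≤ pq x j) (hs : 0 < s)
    (hfreq : HasFrequency (fun j => pq x j ≠ 1) s) :
    Irrational (J x) ∧ Irrational (P (J x)) ∧
      ∀ r f, HasFrequency (fun j => MaximalOnesAt x r j) f →
        HasFrequency (fun j => pq (P (J x)) j = r + 1) (f / s) := by
  classical
  have hn := hfreq.frequently hs
  obtain ⟨b, c, hb, hc, hJ, hP, hcol⟩ := exists_J_eq_and_P_J_eq hn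
  refine ⟨hJ ▸ cfValue_irrational hb, hP ▸ cfValue_irrational hc, fun r f hf => ?_⟩
  rw [hasFrequency_iff]
  choose φ hφ using exists_length_collapse_eq hn
  have hφt : Tendsto φ atTop atTop :=
    tendsto_atTop_mono (fun M => (hφ M).ge.trans (length_collapse_le _ _)) tendsto_id
  have t1 := (tendsto_count_collapse h1 hf).comp hφt
  have t2 := (tendsto_length_collapse_div hfreq).comp hφt
  refine (t1.div t2 hs.ne').congr' ?_
  filter_upwards [eventually_gt_atTop 0] with M hM
  have hpos : 0 < φ M := lt_of_lt_of_le hM ((hφ M).ge.trans (length_collapse_le _ _))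
  have e : Nat.count (fun j => pq (P (J x)) j = r + 1) M
      = (collapseList (stablePart (pq x) (φ M))).count (r + 1) := by
    rw [hcol (φ M), hφ M, list_count_map_range]
    have : (fun j => pq (P (J x)) j = r + 1) = fun j => c j = r + 1 := by
      funext j
      rw [hP, pq_cfValue hc]
    simp only [this]
  simp only [Function.comp, Pi.div_apply, hφ M, e]
  have : (φ M : ℝ) ≠ 0 := by positivity
  have : (M : ℝ) ≠ 0 := by positivity
  field_simp

/-! ### The transfer operator of the Gauss map on monotone functions -/

/-- The weight `(1 + x) / ((k + 1 + x) (k + 2 + x))` of the inverse branch `x ↦ 1 / (k + 1 + x)` in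
the transfer operator with respect to the Gauss measure. -/
def branchWeight (k : ℕ) (x : ℝ) : ℝ := (1 + x) / ((k + 1 + x) * (k + 2 + x))

/-- The inverse branch of the Gauss map with values in `[1 / (k + 2), 1 / (k + 1)]`. -/
def branch (k : ℕ) (x : ℝ) : ℝ := 1 / (k + 1 + x)

/-- The transfer operator of the Gauss map with respect to the Gauss measure. -/
def transfer (f : ℝ → ℝ) (x : ℝ) : ℝ := ∑' k : ℕ, branchWeight k x * f (branch k x)

lemma branchWeight_nonneg (k : ℕ) {x : ℝ} (hx : 0 ≤ x) : 0 ≤ branchWeight k x := by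
  unfold branchWeight; positivity

lemma branch_mem (k : ℕ) {x : ℝ} (hx : 0 ≤ x) : branch k x ∈ Set.Icc (0 : ℝ) 1 := by
  unfold branch
  have : (0 : ℝ) ≤ k := by positivity
  constructor
  · positivity
  · rw [div_le_one (by linarith)]; linarith

lemma hasSum_branchWeight {x : ℝ} (hx : 0 ≤ x) : HasSum (fun k => branchWeight k x) 1 := by
  rw [hasSum_iff_tendsto_nat_of_nonneg fun k => branchWeight_nonneg k hx]
  have e : ∀ N : ℕ, ∑ k ∈ Finset.range N, branchWeight k x = 1 - (1 + x) / (N + (1 + x)) := by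
    intro N
    induction N with
    | zero => simp [div_self (by linarith : (1 + x : ℝ) ≠ 0)]
    | succ N ih =>
      have h1 : (0 : ℝ) < N + (1 + x) := by positivity
      have h2 : (0 : ℝ) < N + 1 + (1 + x) := by positivity
      rw [Finset.sum_range_succ, ih, branchWeight]
      have h3 : (N : ℝ) + 1 + x = N + (1 + x) := by ring
      have h4 : (N : ℝ) + 2 + x = N + 1 + (1 + x) := by ring
      rw [h3, h4]
      push_cast
      field_simp
      ring
  simp only [e]
  have h : Tendsto (fun N : ℕ => (1 + x) / ((N : ℝ) + (1 + x))) atTop (𝓝 0) :=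
    tendsto_const_nhds.div_atTop
      (tendsto_atTop_add_const_right _ _ tendsto_natCast_atTop_atTop)
  simpa using h.const_sub 1

/-- Monotone or antitone functions on the unit interval with values in the unit interval. -/
structure IsMonoDensity (f : ℝ → ℝ) : Prop where
  mem : ∀ t ∈ Set.Icc (0 : ℝ) 1, f t ∈ Set.Icc (0 : ℝ) 1
  mono : AntitoneOn f (Set.Icc 0 1) ∨ MonotoneOn f (Set.Icc 0 1)

lemma hasSum_transfer {f : ℝ → ℝ} (hf : ∀ t ∈ Set.Icc (0 : ℝ) 1, f t ∈ Set.Icc (0 : ℝ) 1) {x : ℝ}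
    (hx : 0 ≤ x) : HasSum (fun k => branchWeight k x * f (branch k x)) (transfer f x) := by
  refine Summable.hasSum ?_
  refine Summable.of_nonneg_of_le (fun k => ?_) (fun k => ?_) (hasSum_branchWeight hx).summable
  · exact mul_nonneg (branchWeight_nonneg k hx) (hf _ (branch_mem k hx)).1
  · exact mul_le_of_le_one_right (branchWeight_nonneg k hx) (hf _ (branch_mem k hx)).2

lemma transfer_mem {f : ℝ → ℝ} (hf : ∀ t ∈ Set.Icc (0 : ℝ) 1, f t ∈ Set.Icc (0 : ℝ) 1) {x : ℝ}
    (hx : 0 ≤ x) : transfer f x ∈ Set.Icc (0 : ℝ) 1 := by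
  have h := hasSum_transfer hf hx
  refine ⟨h.nonneg fun k => mul_nonneg (branchWeight_nonneg k hx) (hf _ (branch_mem k hx)).1, ?_⟩
  exact hasSum_le (fun k => mul_le_of_le_one_right (branchWeight_nonneg k hx)
    (hf _ (branch_mem k hx)).2) h (hasSum_branchWeight hx)

lemma transfer_one_sub {f : ℝ → ℝ} (hf : ∀ t ∈ Set.Icc (0 : ℝ) 1, f t ∈ Set.Icc (0 : ℝ) 1) {x : ℝ}
    (hx : 0 ≤ x) : transfer (fun t => 1 - f t) x = 1 - transfer f x := by
  have h := (hasSum_branchWeight hx).sub (hasSum_transfer hf hx)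
  rw [← h.tsum_eq, transfer]
  congr 1; ext k; ring

/-- As `x` grows, the first weight decreases and all weights from the third on increase. -/
lemma branchWeight_le_of_le {x y : ℝ} (hx : 0 ≤ x) (hxy : x ≤ y) (hy : y ≤ 1) {k : ℕ}
    (hk : 2 ≤ k) : branchWeight k x ≤ branchWeight k y := by
  unfold branchWeight
  have hk' : (2 : ℝ) ≤ k := by exact_mod_cast hk
  have hy0 : 0 ≤ y := hx.trans hxy
  rw [div_le_div_iff₀ (by positivity) (by positivity)]
  have e : (1 + y) * ((k + 1 + x) * (k + 2 + x)) - (1 + x) * ((k + 1 + y) * (k + 2 + y))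
      = (y - x) * ((k : ℝ) * (k + 1) - (1 + x) * (1 + y)) := by ring
  have h1 : (1 + x) * (1 + y) ≤ 4 := by nlinarith
  have h2 : (6 : ℝ) ≤ k * (k + 1) := by nlinarith
  have h3 : 0 ≤ (y - x) * ((k : ℝ) * (k + 1) - (1 + x) * (1 + y)) :=
    mul_nonneg (by linarith) (by linarith)
  linarith

lemma branchWeight_zero_antitone {x y : ℝ} (hx : 0 ≤ x) (hxy : x ≤ y) :
    branchWeight 0 y ≤ branchWeight 0 x := by
  have h : ∀ {z : ℝ}, 0 ≤ z → branchWeight 0 z = 1 / (2 + z) := by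
    intro z hz
    unfold branchWeight
    field_simp
    simp
  rw [h hx, h (hx.trans hxy)]
  exact one_div_le_one_div_of_le (by linarith) (by linarith)

/-- For antitone `f`, moving `x` to the right raises the values of `f` on the branches and shifts
weight to the branches with larger values. -/
lemma transfer_monotoneOn {f : ℝ → ℝ}
    (hf : ∀ t ∈ Set.Icc (0 : ℝ) 1, f t ∈ Set.Icc (0 : ℝ) 1) (ha : AntitoneOn f (Set.Icc 0 1)) :
    MonotoneOn (transfer f) (Set.Icc 0 1) := by
  rintro x ⟨hx, -⟩ y ⟨-, hy⟩ hxy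
  have hy0 : 0 ≤ y := hx.trans hxy
  -- The weights sum to `1`, so the value `r` on the second branch may be subtracted throughout;
  -- afterwards the inequality holds term by term.
  set r := f (branch 1 x) with hr
  have key : ∀ {z : ℝ}, 0 ≤ z →
      HasSum (fun k => branchWeight k z * (f (branch k z) - r)) (transfer f z - r) := by
    intro z hz
    have := (hasSum_transfer hf hz).sub ((hasSum_branchWeight hz).mul_right r)
    simpa only [mul_sub, one_mul] using this
  have hle := hasSum_le (fun k => ?_) (key hx) (key hy0)
  · linarith
  have h1 : f (branch k x) ≤ f (branch k y) := by
    refine ha (branch_mem k hy0) (branch_mem k hx) ?_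
    unfold branch
    exact one_div_le_one_div_of_le (by positivity) (by linarith)
  have h2 := branchWeight_nonneg k hy0
  refine le_trans ?_ (mul_le_mul_of_nonneg_left (sub_le_sub_right h1 r) h2)
  rcases k with _ | _ | k
  · have h3 : f (branch 0 x) ≤ r := by
      refine ha (branch_mem 1 hx) (branch_mem 0 hx) ?_
      unfold branch
      exact one_div_le_one_div_of_le (by positivity) (by simp)
    exact mul_le_mul_of_nonpos_right (branchWeight_zero_antitone hx hxy) (by linarith)
  · simp [hr]
  · have h3 : r ≤ f (branch (k + 2) x) := by
      refine ha (branch_mem _ hx) (branch_mem 1 hx) ?_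
      unfold branch
      refine one_div_le_one_div_of_le (by positivity) ?_
      have : (0 : ℝ) ≤ k := by positivity
      push_cast
      linarith
    exact mul_le_mul_of_nonneg_right (branchWeight_le_of_le hx hxy hy (by omega)) (by linarith)

/-- The transfer operator halves the oscillation of a monotone function. This comes from
`branchWeight k 1 = 2 * branchWeight (k + 1) 0`. -/
lemma transfer_one_sub_transfer_zero_le {f : ℝ → ℝ}
    (hf : ∀ t ∈ Set.Icc (0 : ℝ) 1, f t ∈ Set.Icc (0 : ℝ) 1) (ha : AntitoneOn f (Set.Icc 0 1)) :
    transfer f 1 - transfer f 0 ≤ 1 / 2 * (f 0 - f 1) := by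
  have h0 := hasSum_transfer hf le_rfl
  have h1 := hasSum_transfer hf zero_le_one
  have hw := hasSum_branchWeight (x := 0) le_rfl
  have h0' := (hasSum_nat_add_iff' 1).2 h0
  have hw' := (hasSum_nat_add_iff' 1).2 hw
  have w0 : branchWeight 0 0 = 1 / 2 := by norm_num [branchWeight]
  have b0 : branch 0 0 = 1 := by norm_num [branch]
  simp only [Finset.range_one, Finset.sum_singleton, w0, b0] at h0' hw'
  have hd : ∀ k : ℕ, branchWeight k 1 * f (branch k 1)
      = 2 * (branchWeight (k + 1) 0 * f (branch (k + 1) 0)) := by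
    intro k
    have e1 : branch k 1 = branch (k + 1) 0 := by
      unfold branch; push_cast; congr 1; ring
    have e2 : branchWeight k 1 = 2 * branchWeight (k + 1) 0 := by
      unfold branchWeight; push_cast
      rw [show (k : ℝ) + 2 + 1 = k + 1 + 2 + 0 by ring,
        show (k : ℝ) + 1 + 1 = k + 1 + 1 + 0 by ring]
      ring
    rw [e1, e2]; ring
  simp only [hd] at h1
  have e := h1.unique (h0'.mul_left 2)
  have hle := hasSum_le (fun k => mul_le_mul_of_nonneg_left
    (ha (Set.left_mem_Icc.2 zero_le_one) (branch_mem (k + 1) le_rfl) (branch_mem (k + 1) le_rfl).1)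
    (branchWeight_nonneg (k + 1) le_rfl)) h0' (hw'.mul_right (f 0))
  linarith

lemma IsMonoDensity.one_sub {f : ℝ → ℝ} (hf : IsMonoDensity f) :
    IsMonoDensity fun t => 1 - f t where
  mem t ht := by
    obtain ⟨h1, h2⟩ := hf.mem t ht
    constructor <;> linarith
  mono := hf.mono.symm.imp (fun h _ hx _ hy hxy => sub_le_sub_left (h hx hy hxy) 1)
    (fun h _ hx _ hy hxy => sub_le_sub_left (h hx hy hxy) 1)

lemma IsMonoDensity.transfer {f : ℝ → ℝ} (hf : IsMonoDensity f) :
    IsMonoDensity (transfer f) where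
  mem t ht := transfer_mem hf.mem ht.1
  mono := by
    rcases hf.mono with h | h
    · exact Or.inr (transfer_monotoneOn hf.mem h)
    · left
      have h' : AntitoneOn (fun t => 1 - f t) (Set.Icc 0 1) :=
        fun _ hx _ hy hxy => sub_le_sub_left (h hx hy hxy) 1
      have := transfer_monotoneOn hf.one_sub.mem h'
      intro x hx y hy hxy
      have h2 := this hx hy hxy
      rw [transfer_one_sub hf.mem hx.1, transfer_one_sub hf.mem hy.1] at h2
      linarith

lemma IsMonoDensity.abs_transfer_le {f : ℝ → ℝ} (hf : IsMonoDensity f) :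
    |Jimm.transfer f 1 - Jimm.transfer f 0| ≤ 1 / 2 * |f 1 - f 0| := by
  have m0 : (0 : ℝ) ∈ Set.Icc (0 : ℝ) 1 := Set.left_mem_Icc.2 zero_le_one
  have m1 : (1 : ℝ) ∈ Set.Icc (0 : ℝ) 1 := Set.right_mem_Icc.2 zero_le_one
  rcases hf.mono with h | h
  · rw [abs_of_nonneg (sub_nonneg.2 (transfer_monotoneOn hf.mem h m0 m1 zero_le_one)),
      abs_sub_comm, abs_of_nonneg (sub_nonneg.2 (h m0 m1 zero_le_one))]
    exact transfer_one_sub_transfer_zero_le hf.mem h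
  · have h' : AntitoneOn (fun t => 1 - f t) (Set.Icc 0 1) :=
      fun _ hx _ hy hxy => sub_le_sub_left (h hx hy hxy) 1
    have h1 := transfer_monotoneOn hf.one_sub.mem h' m0 m1 zero_le_one
    have h2 := transfer_one_sub_transfer_zero_le hf.one_sub.mem h'
    rw [transfer_one_sub hf.mem le_rfl, transfer_one_sub hf.mem zero_le_one] at h1 h2
    rw [abs_sub_comm, abs_of_nonneg (by linarith),
      abs_of_nonneg (sub_nonneg.2 (h m0 m1 zero_le_one))]
    linarith

lemma IsMonoDensity.abs_sub_le {f : ℝ → ℝ} (hf : IsMonoDensity f) {x y : ℝ}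
    (hx : x ∈ Set.Icc (0 : ℝ) 1) (hy : y ∈ Set.Icc (0 : ℝ) 1) : |f x - f y| ≤ |f 1 - f 0| := by
  have m0 : (0 : ℝ) ∈ Set.Icc (0 : ℝ) 1 := Set.left_mem_Icc.2 zero_le_one
  have m1 : (1 : ℝ) ∈ Set.Icc (0 : ℝ) 1 := Set.right_mem_Icc.2 zero_le_one
  rcases hf.mono with h | h
  · have a1 := h m0 hx hx.1
    have a2 := h hx m1 hx.2
    have a3 := h m0 hy hy.1
    have a4 := h hy m1 hy.2
    rw [abs_sub_comm (f 1), abs_of_nonneg (by linarith : 0 ≤ f 0 - f 1), abs_le]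
    constructor <;> linarith
  · have a1 := h m0 hx hx.1
    have a2 := h hx m1 hx.2
    have a3 := h m0 hy hy.1
    have a4 := h hy m1 hy.2
    rw [abs_of_nonneg (by linarith : 0 ≤ f 1 - f 0), abs_le]
    constructor <;> linarith

lemma IsMonoDensity.iterate {f : ℝ → ℝ} (hf : IsMonoDensity f) (n : ℕ) :
    IsMonoDensity (Jimm.transfer^[n] f) := by
  induction n with
  | zero => exact hf
  | succ n ih => rw [Function.iterate_succ_apply']; exact ih.transfer

lemma IsMonoDensity.abs_iterate_sub_le {f : ℝ → ℝ} (hf : IsMonoDensity f) (n : ℕ) {x y : ℝ}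
    (hx : x ∈ Set.Icc (0 : ℝ) 1) (hy : y ∈ Set.Icc (0 : ℝ) 1) :
    |Jimm.transfer^[n] f x - Jimm.transfer^[n] f y| ≤ (1 / 2) ^ n := by
  refine ((hf.iterate n).abs_sub_le hx hy).trans ?_
  induction n with
  | zero =>
    obtain ⟨a1, a2⟩ := hf.mem 0 (Set.left_mem_Icc.2 zero_le_one)
    obtain ⟨a3, a4⟩ := hf.mem 1 (Set.right_mem_Icc.2 zero_le_one)
    simp only [Function.iterate_zero, id, pow_zero]
    rw [abs_le]; constructor <;> linarith
  | succ n ih =>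
    rw [Function.iterate_succ_apply', pow_succ']
    exact (hf.iterate n).abs_transfer_le.trans (by gcongr)

/-! ### The Gauss measure -/

/-- The density `1 / (log 2 * (1 + x))` of the Gauss measure. -/
def gaussDensity (x : ℝ) : ℝ := 1 / (Real.log 2 * (1 + x))

/-- The Gauss measure on the unit interval, as a measure on the real line. -/
def gaussMeasure : Measure ℝ :=
  (volume.restrict (Set.Ioo (0 : ℝ) 1)).withDensity fun x => ENNReal.ofReal (gaussDensity x)

lemma measurable_gaussDensity : Measurable gaussDensity := by
  unfold gaussDensity; fun_prop

lemma gaussDensity_pos {x : ℝ} (hx : 0 ≤ x) : 0 < gaussDensity x := by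
  have := Real.log_pos one_lt_two
  unfold gaussDensity; positivity

lemma measurable_gaussMap : Measurable gaussMap := by
  unfold gaussMap; exact measurable_fract.comp measurable_inv

lemma lintegral_gaussMeasure {F : ℝ → ℝ≥0∞} (hF : Measurable F) :
    ∫⁻ x, F x ∂gaussMeasure
      = ∫⁻ x in Set.Ioo (0 : ℝ) 1, ENNReal.ofReal (gaussDensity x) * F x := by
  rw [gaussMeasure, lintegral_withDensity_eq_lintegral_mul _
    measurable_gaussDensity.ennreal_ofReal hF]
  rfl

lemma ae_gaussMeasure_iff {p : ℝ → Prop} :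
    (∀ᵐ x ∂gaussMeasure, p x) ↔ ∀ᵐ x ∂(volume.restrict (Set.Ioo (0 : ℝ) 1)), p x := by
  rw [gaussMeasure, ae_withDensity_iff measurable_gaussDensity.ennreal_ofReal]
  refine eventually_congr ?_
  filter_upwards [ae_restrict_mem measurableSet_Ioo] with x hx
  have := gaussDensity_pos hx.1.le
  simp [this]

lemma ae_mem_Ioo : ∀ᵐ x ∂gaussMeasure, x ∈ Set.Ioo (0 : ℝ) 1 :=
  ae_gaussMeasure_iff.2 (ae_restrict_mem measurableSet_Ioo)

lemma ae_irrational : ∀ᵐ x ∂(volume : Measure ℝ), Irrational x :=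
  (Set.countable_range ((↑) : ℚ → ℝ)).ae_notMem volume

lemma measurable_branch (k : ℕ) : Measurable (branch k) := by
  unfold branch; fun_prop

lemma measurable_branchWeight (k : ℕ) : Measurable (branchWeight k) := by
  unfold branchWeight; fun_prop

lemma branch_injOn (k : ℕ) : Set.InjOn (branch k) (Set.Ioo 0 1) := by
  intro x hx y hy h
  unfold branch at h
  simpa using h

lemma inv_branch (k : ℕ) (t : ℝ) : (branch k t)⁻¹ = ((k + 1 : ℕ) : ℤ) + t := by
  simp [branch]

lemma gaussMap_branch (k : ℕ) {t : ℝ} (ht : t ∈ Set.Ioo (0 : ℝ) 1) :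
    gaussMap (branch k t) = t := by
  rw [gaussMap, inv_branch, Int.fract_intCast_add, Int.fract_eq_self.2 ⟨ht.1.le, ht.2⟩]

lemma pq_branch_zero (k : ℕ) {t : ℝ} (ht : t ∈ Set.Ioo (0 : ℝ) 1) :
    pq (branch k t) 0 = k + 1 := by
  have hm := branch_mem k ht.1.le
  have h1 : branch k t < 1 := by
    have : (0 : ℝ) ≤ k := by positivity
    rw [branch, div_lt_one (by linarith [ht.1])]; linarith [ht.1]
  rw [pq_zero, Int.fract_eq_self.2 ⟨hm.1, h1⟩, inv_branch, ← Int.floor_toNat,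
    Int.floor_intCast_add, Int.floor_eq_zero_iff.2 ⟨ht.1.le, ht.2⟩]
  simp

lemma pairwise_disjoint_branch_image :
    Pairwise (Function.onFun Disjoint fun k => branch k '' Set.Ioo (0 : ℝ) 1) := by
  intro k l hkl
  refine Set.disjoint_left.2 ?_
  rintro _ ⟨t, ht, rfl⟩ ⟨s, hs, h⟩
  have h1 := pq_branch_zero k ht
  have h2 := pq_branch_zero l hs
  rw [h, h1] at h2
  omega

lemma iUnion_branch_image_ae_eq :
    (⋃ k, branch k '' Set.Ioo (0 : ℝ) 1 : Set ℝ) =ᵐ[volume] Set.Ioo (0 : ℝ) 1 := by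
  refine eventuallyEq_set.2 ?_
  filter_upwards [ae_irrational] with x hx
  rw [Set.mem_iUnion]
  constructor
  · rintro ⟨k, t, ht, rfl⟩
    have hm := branch_mem k ht.1.le
    refine ⟨lt_of_le_of_ne hm.1 hx.ne_zero.symm, lt_of_le_of_ne hm.2 hx.ne_one⟩
  · rintro ⟨h0, h1⟩
    have hx1 : 1 < x⁻¹ := (one_lt_inv₀ h0).2 h1
    have hf : 1 ≤ ⌊x⁻¹⌋₊ := (Nat.one_le_floor_iff _).2 hx1.le
    refine ⟨⌊x⁻¹⌋₊ - 1, Int.fract x⁻¹, ⟨?_, Int.fract_lt_one _⟩, ?_⟩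
    · exact lt_of_le_of_ne (Int.fract_nonneg _) (gaussMap_irrational hx).ne_zero.symm
    · have e : ((⌊x⁻¹⌋₊ - 1 : ℕ) : ℝ) + 1 + Int.fract x⁻¹ = x⁻¹ := by
        rw [Nat.cast_sub hf, natCast_floor_eq_intCast_floor (by linarith)]
        have := Int.floor_add_fract x⁻¹
        push_cast
        linarith
      rw [branch, e, one_div, inv_inv]

/-- The transfer operator is dual to composition with the Gauss map. -/
theorem lintegral_mul_comp_gaussMap {F H : ℝ → ℝ≥0∞} (hF : Measurable F) (hH : Measurable H) :
    ∫⁻ x, F x * H (gaussMap x) ∂gaussMeasure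
      = ∫⁻ x, (∑' k : ℕ, ENNReal.ofReal (branchWeight k x) * F (branch k x)) * H x
          ∂gaussMeasure := by
  have hT : Measurable fun x => ∑' k : ℕ, ENNReal.ofReal (branchWeight k x) * F (branch k x) :=
    Measurable.tsum fun k =>
      (measurable_branchWeight k).ennreal_ofReal.mul (hF.comp (measurable_branch k))
  have hL : Measurable fun x => F x * H (gaussMap x) := hF.mul (hH.comp measurable_gaussMap)
  have hR : Measurable fun x =>
      (∑' k : ℕ, ENNReal.ofReal (branchWeight k x) * F (branch k x)) * H x := hT.mul hH
  rw [lintegral_gaussMeasure hL, lintegral_gaussMeasure hR,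
    ← setLIntegral_congr iUnion_branch_image_ae_eq,
    lintegral_iUnion]
  rotate_left
  · intro k
    refine measurableSet_Ioo.image_of_continuousOn_injOn ?_ (branch_injOn k)
    unfold branch
    refine continuousOn_const.div (by fun_prop) fun x hx => ?_
    have := hx.1
    positivity
  · exact pairwise_disjoint_branch_image
  have step : ∀ k : ℕ, ∫⁻ x in branch k '' Set.Ioo (0 : ℝ) 1,
      ENNReal.ofReal (gaussDensity x) * (F x * H (gaussMap x))
      = ∫⁻ x in Set.Ioo (0 : ℝ) 1, ENNReal.ofReal (gaussDensity x) *
        (ENNReal.ofReal (branchWeight k x) * F (branch k x) * H x) := by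
    intro k
    rw [lintegral_image_eq_lintegral_abs_deriv_mul measurableSet_Ioo
      (f' := fun x => -1 / ((k : ℝ) + 1 + x) ^ 2) _ (branch_injOn k)]
    · refine setLIntegral_congr_fun measurableSet_Ioo fun x hx => ?_
      have hx0 := hx.1
      have hl := Real.log_pos one_lt_two
      rw [gaussMap_branch k hx, ← mul_assoc, ← mul_assoc, ← mul_assoc, ← mul_assoc,
        ← ENNReal.ofReal_mul (abs_nonneg _), ← ENNReal.ofReal_mul (gaussDensity_pos hx0.le).le]
      congr 3
      rw [abs_div, abs_neg, abs_one, abs_of_pos (by positivity), gaussDensity, gaussDensity,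
        branchWeight, branch]
      have h1 : (k : ℝ) + 1 + x ≠ 0 := by positivity
      have h2 : (k : ℝ) + 2 + x ≠ 0 := by positivity
      have h3 : 1 + 1 / ((k : ℝ) + 1 + x) = (k + 2 + x) / (k + 1 + x) := by field_simp; ring
      rw [h3]
      field_simp
    · intro x hx
      have h1 : (k : ℝ) + 1 + x ≠ 0 := by have := hx.1; positivity
      have := ((hasDerivAt_id x).const_add ((k : ℝ) + 1)).inv h1
      have h2 : HasDerivAt (branch k) (-1 / ((k : ℝ) + 1 + x) ^ 2) x := by
        refine this.congr_of_eventuallyEq (Eventually.of_forall fun y => ?_)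
        simp [branch]
      exact h2.hasDerivWithinAt
  simp only [step]
  rw [← lintegral_tsum]
  · refine setLIntegral_congr_fun measurableSet_Ioo fun x hx => ?_
    rw [ENNReal.tsum_mul_left, ENNReal.tsum_mul_right]
  · intro k
    exact (measurable_gaussDensity.ennreal_ofReal.mul
      (((measurable_branchWeight k).ennreal_ofReal.mul (hF.comp (measurable_branch k))).mul
        hH)).aemeasurable

lemma tsum_ofReal_branchWeight_mul {f : ℝ → ℝ}
    (hf : ∀ t ∈ Set.Icc (0 : ℝ) 1, f t ∈ Set.Icc (0 : ℝ) 1) {x : ℝ} (hx : 0 ≤ x) :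
    ∑' k : ℕ, ENNReal.ofReal (branchWeight k x) * ENNReal.ofReal (f (branch k x))
      = ENNReal.ofReal (transfer f x) := by
  rw [transfer, ENNReal.ofReal_tsum_of_nonneg
    (fun k => mul_nonneg (branchWeight_nonneg k hx) (hf _ (branch_mem k hx)).1)
    (hasSum_transfer hf hx).summable]
  exact tsum_congr fun k => (ENNReal.ofReal_mul (branchWeight_nonneg k hx)).symm

lemma measurable_transfer {f : ℝ → ℝ} (hf : Measurable f) : Measurable (transfer f) := by
  unfold transfer
  exact Measurable.tsum fun k => (measurable_branchWeight k).mul (hf.comp (measurable_branch k))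

/-- Duality between the iterates of the transfer operator and of the Gauss map. -/
theorem lintegral_mul_comp_iterate_gaussMap {f : ℝ → ℝ} (hf : IsMonoDensity f)
    (hfm : Measurable f) {H : ℝ → ℝ≥0∞} (hH : Measurable H) (n : ℕ) :
    ∫⁻ x, ENNReal.ofReal (f x) * H (gaussMap^[n] x) ∂gaussMeasure
      = ∫⁻ x, ENNReal.ofReal (transfer^[n] f x) * H x ∂gaussMeasure := by
  induction n generalizing f with
  | zero => rfl
  | succ n ih =>
    simp only [Function.iterate_succ_apply]
    rw [← ih hf.transfer (measurable_transfer hfm),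
      lintegral_mul_comp_gaussMap (H := fun x => H (gaussMap^[n] x)) hfm.ennreal_ofReal
        (hH.comp (measurable_gaussMap.iterate n))]
    refine lintegral_congr_ae ?_
    filter_upwards [ae_mem_Ioo] with x hx
    rw [tsum_ofReal_branchWeight_mul hf.mem hx.1.le]

lemma isMonoDensity_one : IsMonoDensity fun _ => 1 where
  mem _ _ := by simp
  mono := Or.inl antitoneOn_const

lemma transfer_one {x : ℝ} (hx : 0 ≤ x) : transfer (fun _ => 1) x = 1 := by
  simpa [transfer] using (hasSum_branchWeight hx).tsum_eq

/-- The Gauss map preserves the Gauss measure. -/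
theorem measurePreserving_gaussMap : MeasurePreserving gaussMap gaussMeasure gaussMeasure := by
  refine ⟨measurable_gaussMap, Measure.ext_of_lintegral _ fun H hH => ?_⟩
  rw [lintegral_map hH measurable_gaussMap]
  have h := lintegral_mul_comp_iterate_gaussMap isMonoDensity_one measurable_const hH 1
  simp only [ENNReal.ofReal_one, one_mul, Function.iterate_one] at h
  rw [h]
  refine lintegral_congr_ae ?_
  filter_upwards [ae_mem_Ioo] with x hx
  rw [transfer_one hx.1.le, ENNReal.ofReal_one, one_mul]

/-! ### Blocks of ones under the Gauss measure -/

/-- The numbers whose first `i` partial quotients are equal to `1`. -/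
def onesBlock (i : ℕ) : Set ℝ := {x | OnesAt x i 0}

/-- The image of the indicator function of `onesBlock i` under the `i`-th iterate of the transfer
operator. -/
def blockDensity (i : ℕ) (x : ℝ) : ℝ :=
  (1 + x) / ((Nat.fib i * x + Nat.fib (i + 1)) * (Nat.fib (i + 1) * x + Nat.fib (i + 2)))

lemma measurable_pq (j : ℕ) : Measurable fun x => pq x j := by
  induction j with
  | zero =>
    simp only [pq_zero]
    exact Nat.measurable_floor.comp (measurable_fract.inv)
  | succ j ih =>
    simp only [pq_succ]
    exact ih.comp measurable_fract.inv

lemma measurableSet_onesBlock (i : ℕ) : MeasurableSet (onesBlock i) := by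
  have : onesBlock i = ⋂ t, ⋂ (_ : t < i), {x | pq x t = 1} := by
    ext x; simp [onesBlock, OnesAt]
  rw [this]
  exact MeasurableSet.iInter fun t => MeasurableSet.iInter fun _ =>
    measurable_pq t (measurableSet_singleton 1)

lemma onesAt_iff {x : ℝ} (hx : x ∈ Set.Ico (0 : ℝ) 1) (i j : ℕ) :
    OnesAt x i j ↔ gaussMap^[j] x ∈ onesBlock i := by
  simp only [onesBlock, OnesAt, Set.mem_ofPred_eq, zero_add, pq_add hx]

lemma onesBlock_succ_iff {x : ℝ} (hx : x ∈ Set.Ico (0 : ℝ) 1) (i : ℕ) :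
    x ∈ onesBlock (i + 1) ↔ x ∈ onesBlock i ∧ pq (gaussMap^[i] x) 0 = 1 := by
  rw [← pq_add hx]
  simp only [onesBlock, OnesAt, Set.mem_ofPred_eq, zero_add, add_zero]
  exact Nat.forall_lt_succ_right

lemma fib_add_one_pos (i : ℕ) : (1 : ℝ) ≤ Nat.fib (i + 1) := by
  exact_mod_cast Nat.fib_pos.2 (Nat.succ_pos i)

lemma fib_add_two_cast (i : ℕ) : (Nat.fib (i + 2) : ℝ) = Nat.fib i + Nat.fib (i + 1) := by
  exact_mod_cast Nat.fib_add_two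

lemma isMonoDensity_blockDensity (i : ℕ) : IsMonoDensity (blockDensity i) where
  mem := by
    rintro x ⟨hx, -⟩
    have hb := fib_add_one_pos i
    have ha : (0 : ℝ) ≤ Nat.fib i := Nat.cast_nonneg _
    unfold blockDensity
    rw [fib_add_two_cast]
    set a := (Nat.fib i : ℝ)
    set b := (Nat.fib (i + 1) : ℝ)
    have hax : 0 ≤ a * x := mul_nonneg ha hx
    have h1 : 1 ≤ a * x + b := by linarith
    have h2 : 1 + x ≤ b * x + (a + b) := by nlinarith
    constructor
    · have : 0 ≤ (a * x + b) * (b * x + (a + b)) := mul_nonneg (by linarith) (by linarith)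
      exact div_nonneg (by linarith) this
    · rw [div_le_one (mul_pos (by linarith) (by linarith))]
      nlinarith
  mono := by
    left
    rintro x ⟨hx, -⟩ y ⟨-, hy⟩ hxy
    have hy0 := hx.trans hxy
    have hb := fib_add_one_pos i
    have ha : (0 : ℝ) ≤ Nat.fib i := Nat.cast_nonneg _
    have hab : (Nat.fib i : ℝ) ≤ Nat.fib (i + 1) := by
      exact_mod_cast Nat.fib_le_fib_succ
    unfold blockDensity
    rw [fib_add_two_cast]
    set a := (Nat.fib i : ℝ)
    set b := (Nat.fib (i + 1) : ℝ)
    have hax : 0 ≤ a * x := mul_nonneg ha hx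
    have hay : 0 ≤ a * y := mul_nonneg ha hy0
    have hbx : 0 ≤ b * x := mul_nonneg (by linarith) hx
    have hby : 0 ≤ b * y := mul_nonneg (by linarith) hy0
    rw [div_le_div_iff₀ (mul_pos (by linarith) (by linarith))
      (mul_pos (by linarith) (by linarith))]
    have e : (1 + x) * ((a * y + b) * (b * y + (a + b)))
        - (1 + y) * ((a * x + b) * (b * x + (a + b)))
        = (y - x) * (a * b * (x + y + x * y) + a * a) := by ring
    have : 0 ≤ (y - x) * (a * b * (x + y + x * y) + a * a) := by
      refine mul_nonneg (by linarith) ?_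
      have : 0 ≤ x * y := mul_nonneg hx hy0
      have : 0 ≤ a * b * (x + y + x * y) :=
        mul_nonneg (mul_nonneg ha (by linarith)) (by linarith)
      nlinarith [mul_self_nonneg a]
    linarith

lemma measurable_blockDensity (i : ℕ) : Measurable (blockDensity i) := by
  unfold blockDensity; fun_prop

lemma branchWeight_mul_blockDensity (i : ℕ) {x : ℝ} (hx : 0 ≤ x) :
    branchWeight 0 x * blockDensity i (branch 0 x) = blockDensity (i + 1) x := by
  have hb := fib_add_one_pos i
  have ha : (0 : ℝ) ≤ Nat.fib i := Nat.cast_nonneg _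
  unfold branchWeight blockDensity branch
  rw [show i + 1 + 2 = (i + 1) + 2 from rfl, fib_add_two_cast (i + 1),
    show i + 1 + 1 = i + 2 from rfl,
    fib_add_two_cast i]
  set a := (Nat.fib i : ℝ)
  set b := (Nat.fib (i + 1) : ℝ)
  have h1 : (1 : ℝ) + x ≠ 0 := by positivity
  have h2 : (2 : ℝ) + x ≠ 0 := by positivity
  have hb0 : 0 < b := by linarith
  have e1 : a * (1 / (((0 : ℕ) : ℝ) + 1 + x)) + b = (b * x + (a + b)) / (1 + x) := by
    simp only [Nat.cast_zero, zero_add]; field_simp; ring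
  have e2 : b * (1 / (((0 : ℕ) : ℝ) + 1 + x)) + (a + b)
      = ((a + b) * x + (b + (a + b))) / (1 + x) := by
    simp only [Nat.cast_zero, zero_add]; field_simp; ring
  have e3 : 1 + 1 / (((0 : ℕ) : ℝ) + 1 + x) = (2 + x) / (1 + x) := by
    simp only [Nat.cast_zero, zero_add]; field_simp; ring
  rw [e1, e2, e3]
  have h3 : b * x + (a + b) ≠ 0 := by positivity
  have h4 : (a + b) * x + (b + (a + b)) ≠ 0 := by positivity
  simp only [Nat.cast_zero, zero_add]
  field_simp

/-- The functions `blockDensity i` represent the blocks `onesBlock i` seen from time `i` on. -/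
theorem lintegral_onesBlock_mul_comp (i : ℕ) {H : ℝ → ℝ≥0∞} (hH : Measurable H) :
    ∫⁻ x, (onesBlock i).indicator 1 x * H (gaussMap^[i] x) ∂gaussMeasure
      = ∫⁻ x, ENNReal.ofReal (blockDensity i x) * H x ∂gaussMeasure := by
  induction i generalizing H with
  | zero =>
    refine lintegral_congr_ae ?_
    filter_upwards [ae_mem_Ioo] with x hx
    have h1 : (1 : ℝ) + x ≠ 0 := by have := hx.1; positivity
    have h2 : x ∈ onesBlock 0 := by simp [onesBlock, OnesAt]
    have h3 : blockDensity 0 x = 1 := by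
      simp [blockDensity, add_comm x, div_self h1]
    simp [h2, h3]
  | succ i ih =>
    have hS : MeasurableSet {x : ℝ | pq x 0 = 1} := measurable_pq 0 (measurableSet_singleton 1)
    have hI : Measurable (({x : ℝ | pq x 0 = 1} : Set ℝ).indicator (1 : ℝ → ℝ≥0∞)) :=
      measurable_one.indicator hS
    have e1 : ∫⁻ x, (onesBlock (i + 1)).indicator 1 x * H (gaussMap^[i + 1] x) ∂gaussMeasure
        = ∫⁻ x, (onesBlock i).indicator 1 x *
          (fun y => ({x : ℝ | pq x 0 = 1} : Set ℝ).indicator 1 y * H (gaussMap y))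
            (gaussMap^[i] x) ∂gaussMeasure := by
      refine lintegral_congr_ae ?_
      filter_upwards [ae_mem_Ioo] with x hx
      simp only [Function.iterate_succ_apply']
      rw [← mul_assoc]
      congr 1
      have := onesBlock_succ_iff ⟨hx.1.le, hx.2⟩ i
      by_cases h1 : x ∈ onesBlock i <;> by_cases h2 : pq (gaussMap^[i] x) 0 = 1 <;>
        simp [Set.indicator, this, h1, h2]
    rw [e1, ih (H := fun y => ({x : ℝ | pq x 0 = 1} : Set ℝ).indicator 1 y * H (gaussMap y))
      (hI.mul (hH.comp measurable_gaussMap))]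
    simp only [← mul_assoc]
    have hF : Measurable fun x => ENNReal.ofReal (blockDensity i x) *
        ({x : ℝ | pq x 0 = 1} : Set ℝ).indicator (1 : ℝ → ℝ≥0∞) x :=
      (measurable_blockDensity i).ennreal_ofReal.mul hI
    rw [lintegral_mul_comp_gaussMap hF hH]
    refine lintegral_congr_ae ?_
    filter_upwards [ae_mem_Ioo] with x hx
    have hx0 := hx.1.le
    congr 1
    rw [tsum_eq_single 0, ← branchWeight_mul_blockDensity i hx0,
      ENNReal.ofReal_mul (branchWeight_nonneg 0 hx0)]
    · simp [Set.indicator, pq_branch_zero 0 hx]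
    · intro l hl
      simp [Set.indicator, pq_branch_zero l hx, hl]

lemma fib_cassini (i : ℕ) :
    (Nat.fib (i + 1) : ℝ) ^ 2 - Nat.fib i * Nat.fib (i + 1) - (Nat.fib i : ℝ) ^ 2 = (-1) ^ i := by
  induction i with
  | zero => simp
  | succ i ih =>
    rw [show i + 1 + 1 = i + 2 from rfl, fib_add_two_cast, pow_succ (-1 : ℝ), ← ih]
    ring

lemma integral_blockDensity (i : ℕ) :
    ∫ x in (0 : ℝ)..1, gaussDensity x * blockDensity i x = k i := by
  have hb := fib_add_one_pos i
  have ha : (0 : ℝ) ≤ Nat.fib i := Nat.cast_nonneg _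
  have hc := fib_cassini i
  have hl := Real.log_pos one_lt_two
  unfold k blockDensity
  rw [fib_add_two_cast]
  set a := (Nat.fib i : ℝ)
  set b := (Nat.fib (i + 1) : ℝ)
  have hb0 : 0 < b := by linarith
  set s : ℝ := (-1) ^ i with hs
  have hss : s * s = 1 := by rw [hs, ← mul_pow]; simp
  have hpos : ∀ x ∈ Set.uIcc (0 : ℝ) 1, 0 ≤ x := by
    intro x hx
    rw [Set.uIcc_of_le zero_le_one] at hx
    exact hx.1
  have hderiv : ∀ x ∈ Set.uIcc (0 : ℝ) 1,
      HasDerivAt (fun x => s / Real.log 2 * (Real.log (b * x + (a + b)) - Real.log (a * x + b)))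
        (gaussDensity x * ((1 + x) / ((a * x + b) * (b * x + (a + b))))) x := by
    intro x hx
    have hx0 := hpos x hx
    have h1 : b * x + (a + b) ≠ 0 := by positivity
    have h2 : a * x + b ≠ 0 := by positivity
    have h3 : (1 : ℝ) + x ≠ 0 := by positivity
    have d1 := (((hasDerivAt_id x).const_mul b).add_const (a + b)).log h1
    have d2 := (((hasDerivAt_id x).const_mul a).add_const b).log h2
    refine ((d1.sub d2).const_mul (s / Real.log 2)).congr_deriv ?_
    unfold gaussDensity
    simp only [id]
    have e : b * 1 / (b * x + (a + b)) - a * 1 / (a * x + b)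
        = s / ((b * x + (a + b)) * (a * x + b)) := by
      rw [← hc]; field_simp; ring
    rw [e, div_mul_div_comm, hss]
    field_simp
  have hcont : ContinuousOn
      (fun x => gaussDensity x * ((1 + x) / ((a * x + b) * (b * x + (a + b))))) (Set.uIcc 0 1) := by
    unfold gaussDensity
    refine ContinuousOn.mul (continuousOn_const.div (by fun_prop) fun x hx => ?_)
      (ContinuousOn.div (by fun_prop) (by fun_prop) fun x hx => ?_)
    · have := hpos x hx; positivity
    · have := hpos x hx; positivity
  rw [intervalIntegral.integral_eq_sub_of_hasDerivAt hderiv hcont.intervalIntegrable, ← mul_sub]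
  congr 1
  have hab : 0 < a + b := by positivity
  have e : 1 + s / (a + b) ^ 2 = (b * 1 + (a + b)) * b / ((a + b) * (a + b)) := by
    rw [← hc]; field_simp; ring
  rw [e, Real.log_div (by positivity) (by positivity), Real.log_mul (by positivity) hb0.ne',
    Real.log_mul hab.ne' hab.ne']
  simp only [mul_zero, zero_add, mul_one]
  rw [add_comm b (a + b), add_comm a b]
  ring

lemma continuousOn_density_mul_blockDensity (i : ℕ) :
    ContinuousOn (fun x => gaussDensity x * blockDensity i x) (Set.Icc 0 1) := by
  have hb := fib_add_one_pos i
  have hb' := fib_add_one_pos (i + 1)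
  have ha : (0 : ℝ) ≤ Nat.fib i := Nat.cast_nonneg _
  have hl := Real.log_pos one_lt_two
  unfold gaussDensity blockDensity
  refine ContinuousOn.mul (continuousOn_const.div (by fun_prop) fun x hx => ?_)
    (ContinuousOn.div (by fun_prop) (by fun_prop) fun x hx => ?_)
  · have := hx.1; positivity
  · have h0 := hx.1
    have : (0 : ℝ) < Nat.fib (i + 1) := by linarith
    have : (0 : ℝ) < Nat.fib (i + 2) := by
      have : (1 : ℝ) ≤ Nat.fib (i + 2) := hb'
      linarith
    positivity

lemma density_mul_blockDensity_nonneg (i : ℕ) {x : ℝ} (hx : x ∈ Set.Icc (0 : ℝ) 1) :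
    0 ≤ gaussDensity x * blockDensity i x :=
  mul_nonneg (gaussDensity_pos hx.1).le ((isMonoDensity_blockDensity i).mem x hx).1

lemma k_nonneg (i : ℕ) : 0 ≤ k i := by
  rw [← integral_blockDensity]
  exact intervalIntegral.integral_nonneg zero_le_one fun x hx =>
    density_mul_blockDensity_nonneg i hx

lemma lintegral_blockDensity (i : ℕ) :
    ∫⁻ x, ENNReal.ofReal (blockDensity i x) ∂gaussMeasure = ENNReal.ofReal (k i) := by
  rw [lintegral_gaussMeasure (measurable_blockDensity i).ennreal_ofReal, ← integral_blockDensity,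
    intervalIntegral.integral_of_le zero_le_one, integral_Ioc_eq_integral_Ioo,
    ofReal_integral_eq_lintegral_ofReal]
  · refine setLIntegral_congr_fun measurableSet_Ioo fun x hx => ?_
    rw [ENNReal.ofReal_mul (gaussDensity_pos hx.1.le).le]
  · exact ((continuousOn_density_mul_blockDensity i).integrableOn_Icc).mono_set
      Set.Ioo_subset_Icc_self
  · filter_upwards [ae_restrict_mem measurableSet_Ioo] with x hx
    exact density_mul_blockDensity_nonneg i (Set.Ioo_subset_Icc_self hx)

lemma k_zero : k 0 = 1 := by
  have := (Real.log_pos one_lt_two).ne'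
  simp only [k, pow_zero, zero_add, Nat.fib_two, Nat.cast_one, one_pow, div_one]
  norm_num

/-- The Gauss measure of `onesBlock i` is `k i`. -/
theorem gaussMeasure_onesBlock (i : ℕ) : gaussMeasure (onesBlock i) = ENNReal.ofReal (k i) := by
  have h := lintegral_onesBlock_mul_comp i (H := 1) measurable_one
  simp only [Pi.one_apply, mul_one] at h
  rw [lintegral_blockDensity, lintegral_indicator_one (measurableSet_onesBlock i)] at h
  exact h

instance isProbabilityMeasure_gaussMeasure : IsProbabilityMeasure gaussMeasure := by
  refine ⟨?_⟩
  have h : onesBlock 0 = Set.univ := by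
    ext x; simp [onesBlock, OnesAt]
  rw [← h, gaussMeasure_onesBlock, k_zero, ENNReal.ofReal_one]

lemma k_le_one (i : ℕ) : k i ≤ 1 := by
  have h := prob_le_one (μ := gaussMeasure) (s := onesBlock i)
  rw [gaussMeasure_onesBlock, ← ENNReal.ofReal_one] at h
  exact (ENNReal.ofReal_le_ofReal_iff zero_le_one).1 h

/-! ### Decay of correlations -/

/-- The iterates of the transfer operator converge exponentially fast to the mean value. -/
lemma abs_transfer_blockDensity_sub_le (i n : ℕ) {x : ℝ} (hx : x ∈ Set.Icc (0 : ℝ) 1) :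
    |transfer^[n] (blockDensity i) x - k i| ≤ (1 / 2) ^ n := by
  have hint : ∫⁻ y, ENNReal.ofReal (transfer^[n] (blockDensity i) y) ∂gaussMeasure
      = ENNReal.ofReal (k i) := by
    have h := lintegral_mul_comp_iterate_gaussMap (isMonoDensity_blockDensity i)
      (measurable_blockDensity i) (H := 1) measurable_one n
    simp only [Pi.one_apply, mul_one] at h
    rw [← h, lintegral_blockDensity]
  have hclose : ∀ y ∈ Set.Ioo (0 : ℝ) 1, _ := fun y hy =>
    abs_le.1 ((isMonoDensity_blockDensity i).abs_iterate_sub_le n hx (Set.Ioo_subset_Icc_self hy))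
  have h0 := ((isMonoDensity_blockDensity i).iterate n).mem x hx
  have hδ : (0 : ℝ) ≤ (1 / 2) ^ n := by positivity
  rw [abs_le]
  constructor
  · have h : ENNReal.ofReal (k i)
        ≤ ENNReal.ofReal (transfer^[n] (blockDensity i) x + (1 / 2) ^ n) := by
      rw [← hint]
      calc _ ≤ ∫⁻ _, ENNReal.ofReal (transfer^[n] (blockDensity i) x + (1 / 2) ^ n)
            ∂gaussMeasure := by
            refine lintegral_mono_ae ?_
            filter_upwards [ae_mem_Ioo] with y hy
            refine ENNReal.ofReal_le_ofReal ?_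
            linarith [(hclose y hy).1]
        _ = _ := by simp
    rw [ENNReal.ofReal_le_ofReal_iff (by linarith [h0.1])] at h
    linarith
  · have h : ENNReal.ofReal (transfer^[n] (blockDensity i) x - (1 / 2) ^ n)
        ≤ ENNReal.ofReal (k i) := by
      rw [← hint]
      calc _ = ∫⁻ _, ENNReal.ofReal (transfer^[n] (blockDensity i) x - (1 / 2) ^ n)
            ∂gaussMeasure := by simp
        _ ≤ _ := by
            refine lintegral_mono_ae ?_
            filter_upwards [ae_mem_Ioo] with y hy
            refine ENNReal.ofReal_le_ofReal ?_
            linarith [(hclose y hy).2]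
    rw [ENNReal.ofReal_le_ofReal_iff (k_nonneg i)] at h
    linarith

lemma abs_measureReal_inter_sub_le (i n : ℕ) :
    |gaussMeasure.real (onesBlock i ∩ gaussMap^[n + i] ⁻¹' onesBlock i) - k i * k i|
      ≤ (1 / 2) ^ n := by
  have hm := measurableSet_onesBlock i
  have hI : Measurable ((onesBlock i).indicator (1 : ℝ → ℝ≥0∞)) := measurable_one.indicator hm
  have hmeas : gaussMeasure (onesBlock i ∩ gaussMap^[n + i] ⁻¹' onesBlock i)
      = ∫⁻ x, ENNReal.ofReal (transfer^[n] (blockDensity i) x) * (onesBlock i).indicator 1 x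
        ∂gaussMeasure := by
    rw [← lintegral_mul_comp_iterate_gaussMap (isMonoDensity_blockDensity i)
      (measurable_blockDensity i) hI,
      ← lintegral_onesBlock_mul_comp i (H := fun x => (onesBlock i).indicator 1 (gaussMap^[n] x))
        (hI.comp (measurable_gaussMap.iterate n)),
      ← lintegral_indicator_one (hm.inter ((measurable_gaussMap.iterate _) hm))]
    refine lintegral_congr fun x => ?_
    rw [← Function.iterate_add_apply]
    by_cases h1 : x ∈ onesBlock i <;> by_cases h2 : gaussMap^[n + i] x ∈ onesBlock i <;>
      simp [Set.indicator, h1, h2]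
  have hc0 := k_nonneg i
  have hc1 := k_le_one i
  have hconst : ∀ r : ℝ, ∫⁻ x, ENNReal.ofReal r * (onesBlock i).indicator 1 x ∂gaussMeasure
      = ENNReal.ofReal (r * k i) := by
    intro r
    rw [lintegral_const_mul _ hI, lintegral_indicator_one hm, gaussMeasure_onesBlock,
      ENNReal.ofReal_mul' hc0]
  have hδ : (0 : ℝ) ≤ (1 / 2) ^ n := by positivity
  have up : gaussMeasure.real (onesBlock i ∩ gaussMap^[n + i] ⁻¹' onesBlock i)
      ≤ (k i + (1 / 2) ^ n) * k i := by
    refine ENNReal.toReal_le_of_le_ofReal (by positivity) ?_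
    rw [hmeas, ← hconst]
    refine lintegral_mono_ae ?_
    filter_upwards [ae_mem_Ioo] with x hx
    have := abs_le.1 (abs_transfer_blockDensity_sub_le i n (Set.Ioo_subset_Icc_self hx))
    gcongr
    linarith [this.2]
  have lo : (k i - (1 / 2) ^ n) * k i
      ≤ gaussMeasure.real (onesBlock i ∩ gaussMap^[n + i] ⁻¹' onesBlock i) := by
    rw [measureReal_def, ← ENNReal.ofReal_le_iff_le_toReal (measure_ne_top _ _), hmeas, ← hconst]
    refine lintegral_mono_ae ?_
    filter_upwards [ae_mem_Ioo] with x hx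
    have := abs_le.1 (abs_transfer_blockDensity_sub_le i n (Set.Ioo_subset_Icc_self hx))
    gcongr
    linarith [this.1]
  have : (1 / 2 : ℝ) ^ n * k i ≤ (1 / 2) ^ n := mul_le_of_le_one_right hδ hc1
  rw [abs_le]
  constructor <;> nlinarith

/-- Exponential decay of correlations for the blocks of ones. -/
theorem abs_correlation_le (i d : ℕ) :
    |gaussMeasure.real (onesBlock i ∩ gaussMap^[d] ⁻¹' onesBlock i) - k i * k i|
      ≤ 2 ^ i * (1 / 2) ^ d := by
  rcases le_or_gt i d with h | h
  · obtain ⟨n, rfl⟩ := Nat.exists_eq_add_of_le' h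
    refine (abs_measureReal_inter_sub_le i n).trans (le_of_eq ?_)
    rw [pow_add, mul_comm ((1 / 2 : ℝ) ^ n), ← mul_assoc, ← mul_pow]
    norm_num
  · have h1 : (1 : ℝ) ≤ 2 ^ i * (1 / 2) ^ d := by
      obtain ⟨n, rfl⟩ := Nat.exists_eq_add_of_le h.le
      rw [pow_add, mul_right_comm, ← mul_pow]
      norm_num
      exact one_le_pow₀ one_le_two
    refine le_trans ?_ h1
    have a1 := k_nonneg i
    have a2 := k_le_one i
    have a3 : gaussMeasure.real (onesBlock i ∩ gaussMap^[d] ⁻¹' onesBlock i) ≤ 1 :=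
      measureReal_le_one
    have a4 : 0 ≤ gaussMeasure.real (onesBlock i ∩ gaussMap^[d] ⁻¹' onesBlock i) :=
      measureReal_nonneg
    rw [abs_le]
    constructor <;> nlinarith

/-! ### A strong law of large numbers for exponentially decaying correlations -/

/-- The second moments of the centred sums grow at most linearly. -/
lemma integral_sq_sum_le {α : Type*} [MeasurableSpace α] {μ : Measure α} [IsProbabilityMeasure μ]
    {Y : ℕ → α → ℝ} (hY : ∀ j, Measurable (Y j)) (hb : ∀ j x, |Y j x| ≤ 1) {K : ℝ} (hK : 1 ≤ K)
    (hcov : ∀ j d, ∫ x, Y j x * Y (j + d) x ∂μ ≤ K * (1 / 2) ^ d) (N : ℕ) :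
    ∫ x, (∑ j ∈ Finset.range N, Y j x) ^ 2 ∂μ ≤ 3 * K * N := by
  have hS : ∀ N, Measurable fun x => ∑ j ∈ Finset.range N, Y j x := fun N =>
    Finset.measurable_fun_sum _ fun j _ => hY j
  have hSb : ∀ N x, |∑ j ∈ Finset.range N, Y j x| ≤ N := by
    intro N x
    refine (Finset.abs_sum_le_sum_abs _ _).trans ?_
    refine (Finset.sum_le_sum fun j _ => hb j x).trans ?_
    simp
  have hint : ∀ {Z : α → ℝ} (C : ℝ), Measurable Z → (∀ x, |Z x| ≤ C) → Integrable Z μ := by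
    intro Z C hZ hC
    exact Integrable.of_bound hZ.aestronglyMeasurable C (Eventually.of_forall hC)
  have hYY : ∀ i j, Integrable (fun x => Y i x * Y j x) μ := by
    intro i j
    refine hint 1 ((hY i).mul (hY j)) fun x => ?_
    rw [abs_mul]
    exact mul_le_one₀ (hb i x) (abs_nonneg _) (hb j x)
  induction N with
  | zero => simp
  | succ N ih =>
    have e : ∀ x, (∑ j ∈ Finset.range (N + 1), Y j x) ^ 2
        = (∑ j ∈ Finset.range N, Y j x) ^ 2 + 2 * ∑ j ∈ Finset.range N, Y j x * Y N x
          + Y N x * Y N x := by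
      intro x
      rw [Finset.sum_range_succ, ← Finset.sum_mul]
      ring
    have i1 : Integrable (fun x => (∑ j ∈ Finset.range N, Y j x) ^ 2) μ := by
      refine hint ((N : ℝ) ^ 2) ((hS N).pow_const 2) fun x => ?_
      rw [abs_pow]
      exact pow_le_pow_left₀ (abs_nonneg _) (hSb N x) 2
    have i2 : Integrable (fun x => 2 * ∑ j ∈ Finset.range N, Y j x * Y N x) μ :=
      (integrable_finsetSum _ fun j _ => hYY j N).const_mul 2
    have i12 : Integrable (fun x => (∑ j ∈ Finset.range N, Y j x) ^ 2
        + 2 * ∑ j ∈ Finset.range N, Y j x * Y N x) μ := i1.add i2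
    simp only [e]
    rw [integral_add i12 (hYY N N), integral_add i1 i2, integral_const_mul,
      integral_finsetSum _ fun j _ => hYY j N]
    have h1 : ∑ j ∈ Finset.range N, ∫ x, Y j x * Y N x ∂μ
        ≤ ∑ j ∈ Finset.range N, K * (1 / 2) * (1 / 2) ^ (N - 1 - j) := by
      refine Finset.sum_le_sum fun j hj => ?_
      have hj' := Finset.mem_range.1 hj
      have := hcov j (N - 1 - j + 1)
      rw [show j + (N - 1 - j + 1) = N by omega, pow_succ'] at this
      rwa [mul_assoc]
    rw [Finset.sum_range_reflect (fun j => K * (1 / 2) * (1 / 2 : ℝ) ^ j), ← Finset.mul_sum] at h1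
    have h2 : ∑ j ∈ Finset.range N, (1 / 2 : ℝ) ^ j ≤ 2 := by
      refine (Summable.sum_le_tsum _ (fun _ _ => by positivity) summable_geometric_two).trans ?_
      rw [tsum_geometric_two]
    have h3 := hcov N 0
    simp only [add_zero, pow_zero, mul_one] at h3
    have h4 : K * (1 / 2) * ∑ j ∈ Finset.range N, (1 / 2 : ℝ) ^ j ≤ K * (1 / 2) * 2 := by gcongr
    push_cast
    linarith

/-- If the correlations of the `[0, 1]`-valued variables `χ j` decay exponentially, then their
averages converge almost surely: by Borel-Cantelli along the squares, and then along all integers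
as the sums are monotone. -/
theorem ae_tendsto_average {α : Type*} [MeasurableSpace α] {μ : Measure α}
    [IsProbabilityMeasure μ] {χ : ℕ → α → ℝ} (hχ : ∀ j, Measurable (χ j))
    (hχ01 : ∀ j x, χ j x ∈ Set.Icc (0 : ℝ) 1) {c : ℝ} (hc : c ∈ Set.Icc (0 : ℝ) 1) {K : ℝ}
    (hK : 1 ≤ K) (hcov : ∀ j d, ∫ x, (χ j x - c) * (χ (j + d) x - c) ∂μ ≤ K * (1 / 2) ^ d) :
    ∀ᵐ x ∂μ, Tendsto (fun N : ℕ => (∑ j ∈ Finset.range N, χ j x) / N) atTop (𝓝 c) := by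
  have hYm : ∀ j, Measurable fun x => χ j x - c := fun j => (hχ j).sub_const c
  have hYb : ∀ j x, |χ j x - c| ≤ 1 := by
    intro j x
    obtain ⟨h1, h2⟩ := hχ01 j x
    obtain ⟨h3, h4⟩ := hc
    rw [abs_le]; constructor <;> linarith
  have hmom := integral_sq_sum_le hYm hYb hK hcov
  set S : ℕ → α → ℝ := fun N x => ∑ j ∈ Finset.range N, (χ j x - c) with hS
  have hSm : ∀ N, Measurable (S N) := fun N => Finset.measurable_fun_sum _ fun j _ => hYm j
  have hSb : ∀ N x, |S N x| ≤ N := by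
    intro N x
    refine (Finset.abs_sum_le_sum_abs _ _).trans ?_
    refine (Finset.sum_le_sum fun j _ => hYb j x).trans ?_
    simp
  set q : ℕ → ℕ := fun n => (n + 1) ^ 2 with hq
  have hq0 : ∀ n, (0 : ℝ) < q n := fun n => by simp only [hq]; positivity
  -- The second moments along the squares are summable.
  have hfin : ∫⁻ x, ∑' n, ENNReal.ofReal ((S (q n) x / q n) ^ 2) ∂μ ≠ ∞ := by
    rw [lintegral_tsum fun n => (((hSm _).div_const _).pow_const 2).ennreal_ofReal.aemeasurable]
    have hle : ∀ n, ∫⁻ x, ENNReal.ofReal ((S (q n) x / q n) ^ 2) ∂μ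
        ≤ ENNReal.ofReal (3 * K * (1 / ((n : ℝ) + 1) ^ 2)) := by
      intro n
      rw [← ofReal_integral_eq_lintegral_ofReal]
      · refine ENNReal.ofReal_le_ofReal ?_
        simp only [div_pow]
        rw [integral_div, div_le_iff₀ (by have := hq0 n; positivity)]
        refine (hmom (q n)).trans (le_of_eq ?_)
        simp only [hq]
        push_cast
        field_simp
      · refine Integrable.of_bound ((hSm _).div_const _ |>.pow_const 2).aestronglyMeasurable 1
          (Eventually.of_forall fun x => ?_)
        rw [Real.norm_eq_abs, abs_pow]
        refine pow_le_one₀ (abs_nonneg _) ?_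
        rw [abs_div, abs_of_pos (hq0 n), div_le_one (hq0 n)]
        exact hSb _ x
      · exact Eventually.of_forall fun x => sq_nonneg _
    refine ne_top_of_le_ne_top ?_ (ENNReal.tsum_le_tsum hle)
    have hsum : Summable fun n : ℕ => 3 * K * (1 / ((n : ℝ) + 1) ^ 2) := by
      refine Summable.mul_left _ ?_
      have := (summable_nat_add_iff 1).2 (Real.summable_one_div_nat_pow.2 one_lt_two)
      simpa using this
    rw [← ENNReal.ofReal_tsum_of_nonneg (fun n => by positivity) hsum]
    exact ENNReal.ofReal_ne_top
  have hae := ae_lt_top (Measurable.tsum fun n =>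
    (((hSm (q n)).div_const (q n : ℝ)).pow_const 2).ennreal_ofReal) hfin
  filter_upwards [hae] with x hx
  have h0 : Tendsto (fun n => (S (q n) x / q n) ^ 2) atTop (𝓝 0) := by
    have := (ENNReal.tendsto_toReal ENNReal.zero_ne_top).comp
      (ENNReal.tendsto_atTop_zero_of_tsum_ne_top hx.ne)
    refine this.congr fun n => ?_
    simp only [Function.comp]
    exact ENNReal.toReal_ofReal (sq_nonneg _)
  have h1 : Tendsto (fun n => S (q n) x / q n) atTop (𝓝 0) := by
    have := h0.sqrt
    rw [Real.sqrt_zero] at this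
    simp only [Real.sqrt_sq_eq_abs] at this
    exact (tendsto_zero_iff_abs_tendsto_zero _).2 this
  refine tendsto_div_of_monotone_of_exists_subseq_tendsto_div
    (fun N => ∑ j ∈ Finset.range N, χ j x) c ?_ ?_
  · refine monotone_nat_of_le_succ fun N => ?_
    rw [Finset.sum_range_succ]
    exact le_add_of_nonneg_right (hχ01 N x).1
  · intro a ha
    refine ⟨q, ?_, ?_, ?_⟩
    · have ht : Tendsto (fun n : ℕ => (1 + 1 / ((n : ℝ) + 1)) ^ 2) atTop (𝓝 ((1 + 0) ^ 2)) :=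
        (tendsto_one_div_add_atTop_nhds_zero_nat.const_add 1).pow 2
      rw [add_zero, one_pow] at ht
      filter_upwards [ht.eventually_lt_const ha] with n hn
      have e : ((q (n + 1) : ℕ) : ℝ) = (1 + 1 / ((n : ℝ) + 1)) ^ 2 * q n := by
        simp only [hq]
        push_cast
        field_simp
      rw [e]
      exact mul_le_mul_of_nonneg_right hn.le (hq0 n).le
    · refine tendsto_atTop_mono (fun n => ?_) tendsto_id
      simp only [hq, id]
      nlinarith
    · have := h1.add_const c
      rw [zero_add] at this
      refine this.congr fun n => ?_
      have := (hq0 n).ne'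
      simp only [hS, Finset.sum_sub_distrib, Finset.sum_const, Finset.card_range, nsmul_eq_mul]
      field_simp
      ring

/-! ### Frequencies of blocks of ones -/

lemma integral_indicator_correlation_le (i j d : ℕ) :
    ∫ x, ((onesBlock i).indicator 1 (gaussMap^[j] x) - k i) *
      ((onesBlock i).indicator 1 (gaussMap^[j + d] x) - k i) ∂gaussMeasure
      ≤ 2 ^ i * (1 / 2) ^ d := by
  have hm := measurableSet_onesBlock i
  have hpre : ∀ n, MeasurableSet (gaussMap^[n] ⁻¹' onesBlock i) := fun n =>
    (measurable_gaussMap.iterate n) hm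
  have hind : ∀ n x, (onesBlock i).indicator (1 : ℝ → ℝ) (gaussMap^[n] x)
      = (gaussMap^[n] ⁻¹' onesBlock i).indicator 1 x := fun n x => rfl
  have hint : ∀ {s : Set ℝ}, MeasurableSet s →
      Integrable (s.indicator (1 : ℝ → ℝ)) gaussMeasure := fun hs =>
    (integrable_const (1 : ℝ)).indicator hs
  have hmeas : ∀ n, gaussMeasure.real (gaussMap^[n] ⁻¹' onesBlock i) = k i := by
    intro n
    rw [measureReal_def, (measurePreserving_gaussMap.iterate n).measure_preimage
      hm.nullMeasurableSet, gaussMeasure_onesBlock, ENNReal.toReal_ofReal (k_nonneg i)]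
  have hinter : gaussMeasure.real (gaussMap^[j] ⁻¹' onesBlock i ∩ gaussMap^[j + d] ⁻¹' onesBlock i)
      = gaussMeasure.real (onesBlock i ∩ gaussMap^[d] ⁻¹' onesBlock i) := by
    rw [measureReal_def, measureReal_def, ← (measurePreserving_gaussMap.iterate j).measure_preimage
      (hm.inter (hpre d)).nullMeasurableSet, Set.preimage_inter, ← Set.preimage_comp,
      ← Function.iterate_add, add_comm d j]
  have e : ∀ x, ((onesBlock i).indicator 1 (gaussMap^[j] x) - k i) *
      ((onesBlock i).indicator 1 (gaussMap^[j + d] x) - k i)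
      = (gaussMap^[j] ⁻¹' onesBlock i ∩ gaussMap^[j + d] ⁻¹' onesBlock i).indicator (1 : ℝ → ℝ) x
        - k i * (gaussMap^[j] ⁻¹' onesBlock i).indicator (1 : ℝ → ℝ) x
        - k i * (gaussMap^[j + d] ⁻¹' onesBlock i).indicator (1 : ℝ → ℝ) x + k i * k i := by
    intro x
    rw [hind, hind, Set.inter_indicator_one, Pi.mul_apply]
    ring
  have i1 := hint ((hpre j).inter (hpre (j + d)))
  have i2 := (hint (hpre j)).const_mul (k i)
  have i3 := (hint (hpre (j + d))).const_mul (k i)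
  have i12 : Integrable (fun x =>
      (gaussMap^[j] ⁻¹' onesBlock i ∩ gaussMap^[j + d] ⁻¹' onesBlock i).indicator (1 : ℝ → ℝ) x
        - k i * (gaussMap^[j] ⁻¹' onesBlock i).indicator (1 : ℝ → ℝ) x) gaussMeasure := i1.sub i2
  have i123 : Integrable (fun x =>
      (gaussMap^[j] ⁻¹' onesBlock i ∩ gaussMap^[j + d] ⁻¹' onesBlock i).indicator (1 : ℝ → ℝ) x
        - k i * (gaussMap^[j] ⁻¹' onesBlock i).indicator (1 : ℝ → ℝ) x
        - k i * (gaussMap^[j + d] ⁻¹' onesBlock i).indicator (1 : ℝ → ℝ) x) gaussMeasure :=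
    i12.sub i3
  simp only [e]
  rw [integral_add i123 (integrable_const _), integral_sub i12 i3,
    integral_sub i1 i2, integral_const_mul, integral_const_mul,
    integral_indicator_one ((hpre j).inter (hpre (j + d))), integral_indicator_one (hpre j),
    integral_indicator_one (hpre (j + d)), hmeas, hmeas, hinter, integral_const]
  have := (abs_le.1 (abs_correlation_le i d)).2
  simp only [probReal_univ, smul_eq_mul, one_mul]
  linarith

theorem ae_hasFrequency_onesAt (i : ℕ) :
    ∀ᵐ x ∂gaussMeasure, HasFrequency (fun j => OnesAt x i j) (k i) := by
  classical
  have h := ae_tendsto_average (μ := gaussMeasure)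
    (χ := fun j x => (onesBlock i).indicator (1 : ℝ → ℝ) (gaussMap^[j] x))
    (fun j => (measurable_one.indicator (measurableSet_onesBlock i)).comp
      (measurable_gaussMap.iterate j))
    (fun j x => by by_cases h : gaussMap^[j] x ∈ onesBlock i <;> simp [h])
    ⟨k_nonneg i, k_le_one i⟩ (K := 2 ^ i) (one_le_pow₀ one_le_two)
    (integral_indicator_correlation_le i)
  filter_upwards [h, ae_mem_Ioo] with x hx hx'
  rw [hasFrequency_iff]
  refine hx.congr fun N => ?_
  congr 1
  rw [Nat.count_eq_card_filter_range, ← Finset.sum_boole]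
  refine Finset.sum_congr rfl fun j _ => ?_
  have := onesAt_iff ⟨hx'.1.le, hx'.2⟩ i j
  by_cases h : gaussMap^[j] x ∈ onesBlock i <;> simp [this, h]

lemma HasFrequency.shift {S : ℕ → Prop} {c : ℝ} (h : HasFrequency S c) :
    HasFrequency (fun j => S (j + 1)) c := by
  classical
  rw [hasFrequency_iff] at h ⊢
  refine tendsto_div_of_abs_sub_le (K := (1 : ℕ)) h (Eventually.of_forall fun N => ?_)
  have e1 := Nat.count_succ S N
  have e2 := Nat.count_succ' S N
  have b1 : (if S N then 1 else 0) ≤ 1 := by split_ifs <;> omega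
  have b2 : (if S 0 then 1 else 0) ≤ 1 := by split_ifs <;> omega
  rw [abs_le]
  constructor
  · rw [neg_le_sub_iff_le_add]
    exact_mod_cast (show Nat.count S N ≤ Nat.count (fun j => S (j + 1)) N + 1 by omega)
  · rw [sub_le_iff_le_add]
    exact_mod_cast (show Nat.count (fun j => S (j + 1)) N ≤ 1 + Nat.count S N by omega)

lemma onesAt_succ (x : ℝ) (i j : ℕ) : OnesAt x (i + 1) j ↔ OnesAt x i j ∧ pq x (j + i) = 1 :=
  Nat.forall_lt_succ_right

lemma onesAt_succ' (x : ℝ) (i j : ℕ) : OnesAt x (i + 1) j ↔ pq x j = 1 ∧ OnesAt x i (j + 1) := by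
  simp only [OnesAt]
  constructor
  · exact fun h => ⟨h 0 (by omega), fun t ht => by
      rw [show j + 1 + t = j + (t + 1) by omega]; exact h _ (by omega)⟩
  · rintro ⟨h0, h⟩ (_ | t) ht
    · exact h0
    · rw [show j + (t + 1) = j + 1 + t by omega]; exact h t (by omega)

open Classical in
/-- Inclusion and exclusion of the digits that precede and follow a block. -/
lemma count_maximalOnesAt {x : ℝ} (h1 : ∀ j, 1 ≤ pq x j) (i N : ℕ) :
    Nat.count (fun j => MaximalOnesAt x i j) N + Nat.count (fun j => OnesAt x (i + 1) j) N
      + Nat.count (fun j => OnesAt x (i + 1) (j + 1)) N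
      = Nat.count (fun j => OnesAt x i (j + 1)) N + Nat.count (fun j => OnesAt x (i + 2) j) N := by
  induction N with
  | zero => simp
  | succ N ih =>
    have hne : ∀ j, 1 < pq x j ↔ ¬ pq x j = 1 := fun j => by have := h1 j; omega
    have e1 : MaximalOnesAt x i N ↔
        ¬ pq x N = 1 ∧ OnesAt x i (N + 1) ∧ ¬ pq x (N + 1 + i) = 1 := by
      rw [MaximalOnesAt, hne, hne, show N + i + 1 = N + 1 + i by omega]
    have e2 := onesAt_succ' x i N
    have e3 := onesAt_succ x i (N + 1)
    have e4 := onesAt_succ' x (i + 1) N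
    rw [e3] at e4
    simp only [Nat.count_succ]
    by_cases p1 : pq x N = 1 <;> by_cases p2 : OnesAt x i (N + 1) <;>
      by_cases p3 : pq x (N + 1 + i) = 1 <;> simp [e1, e2, e3, e4, p1, p2, p3] <;> omega

lemma hasFrequency_maximalOnesAt {x : ℝ} (h1 : ∀ j, 1 ≤ pq x j)
    (h : ∀ i, HasFrequency (fun j => OnesAt x i j) (k i)) (i : ℕ) :
    HasFrequency (fun j => MaximalOnesAt x i j) (m i) := by
  classical
  have a1 := hasFrequency_iff.1 (h i).shift
  have a2 := hasFrequency_iff.1 (h (i + 1)).shift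
  have a3 := hasFrequency_iff.1 (h (i + 1))
  have a4 := hasFrequency_iff.1 (h (i + 2))
  rw [hasFrequency_iff, m, show k i - 2 * k (i + 1) + k (i + 2)
    = k i + k (i + 2) - k (i + 1) - k (i + 1) by ring]
  refine (((a1.add a4).sub a3).sub a2).congr fun N => ?_
  have e : (Nat.count (fun j => MaximalOnesAt x i j) N : ℝ)
      + Nat.count (fun j => OnesAt x (i + 1) j) N
      + Nat.count (fun j => OnesAt x (i + 1) (j + 1)) N
      = Nat.count (fun j => OnesAt x i (j + 1)) N + Nat.count (fun j => OnesAt x (i + 2) j) N := by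
    exact_mod_cast count_maximalOnesAt h1 i N
  rw [← add_div, ← sub_div, ← sub_div]
  congr 1
  linarith

lemma HasFrequency.nonneg {S : ℕ → Prop} {c : ℝ} (h : HasFrequency S c) : 0 ≤ c :=
  ge_of_tendsto' h fun N => by positivity

/-! ### The sum of the frequencies -/

lemma k_one : k 1 = Real.log (4 / 3) / Real.log 2 := by
  have e : Real.log (4 / 3) = - Real.log (3 / 4) := by
    rw [← Real.log_inv]; norm_num
  have hf : Nat.fib 3 = 2 := rfl
  rw [k, e, show 1 + 2 = 3 from rfl, hf]
  norm_num
  ring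

lemma one_sub_k_one : 1 - k 1 = Real.log (3 / 2) / Real.log 2 := by
  have hl := (Real.log_pos one_lt_two).ne'
  have e : Real.log (3 / 2) = Real.log 2 - Real.log (4 / 3) := by
    rw [← Real.log_div (by norm_num) (by norm_num)]; norm_num
  rw [k_one, e, sub_div, div_self hl]

lemma tendsto_k : Tendsto k atTop (𝓝 0) := by
  have hfib : Tendsto (fun i : ℕ => (Nat.fib (i + 2) : ℝ)) atTop atTop :=
    tendsto_natCast_atTop_atTop.comp Nat.fib_add_two_strictMono.tendsto_atTop
  have h1 : Tendsto (fun i : ℕ => (-1 : ℝ) ^ i / (Nat.fib (i + 2) : ℝ) ^ 2) atTop (𝓝 0) := by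
    have h2 : Tendsto (fun i : ℕ => 1 / (Nat.fib (i + 2) : ℝ) ^ 2) atTop (𝓝 0) :=
      tendsto_const_nhds.div_atTop ((tendsto_pow_atTop two_ne_zero).comp hfib)
    refine squeeze_zero_norm (fun i => le_of_eq ?_) h2
    simp
  have h3 : Tendsto (fun i : ℕ => Real.log (1 + (-1 : ℝ) ^ i / (Nat.fib (i + 2) : ℝ) ^ 2)) atTop
      (𝓝 0) := by
    have := (h1.const_add 1).log (by norm_num)
    simpa using this
  have h4 : Tendsto (fun i : ℕ => |Real.log 2|⁻¹ *
      |Real.log (1 + (-1 : ℝ) ^ i / (Nat.fib (i + 2) : ℝ) ^ 2)|) atTop (𝓝 0) := by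
    simpa using h3.abs.const_mul |Real.log 2|⁻¹
  refine squeeze_zero_norm (fun i => le_of_eq ?_) h4
  rw [k, Real.norm_eq_abs, abs_mul, abs_div, abs_pow, abs_neg, abs_one, one_pow, one_div]

lemma hasSum_m (h : ∀ i, 0 ≤ m i) : HasSum m (Real.log (3 / 2) / Real.log 2) := by
  rw [hasSum_iff_tendsto_nat_of_nonneg h]
  have e : ∀ N, ∑ i ∈ Finset.range N, m i = (1 - k 1) - (k N - k (N + 1)) := by
    intro N
    induction N with
    | zero => simp [k_zero]
    | succ N ih => rw [Finset.sum_range_succ, ih, m]; ring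
  simp only [e]
  have := (tendsto_k.sub (tendsto_k.comp (tendsto_add_atTop_nat 1))).const_sub (1 - k 1)
  rw [sub_zero, sub_zero, one_sub_k_one] at this
  rw [one_sub_k_one]
  exact this

/-- Almost every number in the unit interval has the stated frequencies. -/
theorem ae_hasFrequency : ∀ᵐ x ∂(volume.restrict (Set.Ioo (0 : ℝ) 1)),
    (∀ j, 1 ≤ pq x j) ∧ ∀ i, HasFrequency (fun j => OnesAt x i j) (k i) := by
  have h := ae_gaussMeasure_iff.1 (ae_all_iff.2 ae_hasFrequency_onesAt)
  filter_upwards [h, ae_restrict_mem measurableSet_Ioo, ae_restrict_of_ae ae_irrational]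
    with x hx hx1 hx2
  exact ⟨one_le_pq hx2 ⟨hx1.1.le, hx1.2⟩, hx⟩

/-- A frequency is nonnegative, and `m i` is one for some number. -/
lemma m_nonneg (i : ℕ) : 0 ≤ m i := by
  have : NeBot (ae (volume.restrict (Set.Ioo (0 : ℝ) 1))) := by
    rw [ae_neBot, Ne, Measure.restrict_eq_zero]
    simp
  obtain ⟨x, h1, h2⟩ := ae_hasFrequency.exists
  exact (hasFrequency_maximalOnesAt h1 h2 i).nonneg

end Jimm

end

theorem mainTheorem2 {Ω : Type*} [MeasurableSpace Ω] (ℙ : Measure Ω) [IsProbabilityMeasure ℙ]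
    (X : Ω → ℝ) (hX : pdf.IsUniform X (Set.Icc (0 : ℝ) 1) ℙ volume) :
    HasSum Jimm.m (Real.log (3 / 2) / Real.log 2) ∧
    ∀ᵐ ω ∂ℙ,
      (∀ i : ℕ, Jimm.HasFrequency (fun j => Jimm.OnesAt (X ω) i j) (Jimm.k i)) ∧
      (∀ i : ℕ, Jimm.HasFrequency (fun j => Jimm.MaximalOnesAt (X ω) i j) (Jimm.m i)) ∧
      Irrational (Jimm.J (X ω)) ∧ Irrational (Jimm.P (Jimm.J (X ω))) ∧
      (∀ i : ℕ, 1 ≤ i →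
        Jimm.HasFrequency (fun j => Jimm.pq (Jimm.P (Jimm.J (X ω))) j = i) (Jimm.u i)) := by
  have hsum := Jimm.hasSum_m Jimm.m_nonneg
  refine ⟨hsum, ?_⟩
  have hvol : volume (Set.Icc (0 : ℝ) 1) = 1 := by simp
  have hXm : AEMeasurable X ℙ := hX.aemeasurable (by rw [hvol]; simp) (by rw [hvol]; simp)
  have hmap : Measure.map X ℙ = volume.restrict (Set.Ioo (0 : ℝ) 1) := by
    rw [show Measure.map X ℙ = ProbabilityTheory.cond volume (Set.Icc (0 : ℝ) 1) from hX,
      ProbabilityTheory.cond, hvol, inv_one, one_smul,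
      Measure.restrict_congr_set Ioo_ae_eq_Icc]
  have hae := Jimm.ae_hasFrequency
  rw [← hmap] at hae
  filter_upwards [ae_of_ae_map hXm hae] with ω hω
  obtain ⟨h1, h2⟩ := hω
  have h3 := Jimm.hasFrequency_maximalOnesAt h1 h2
  have hs : 0 < Real.log (3 / 2) / Real.log 2 :=
    div_pos (Real.log_pos (by norm_num)) (Real.log_pos one_lt_two)
  have hne : Jimm.HasFrequency (fun j => Jimm.pq (X ω) j ≠ 1) (Real.log (3 / 2) / Real.log 2) := by
    rw [← Jimm.one_sub_k_one]
    have := (h2 1).not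
    simpa [Jimm.OnesAt] using this
  obtain ⟨hJ, hP, hfreq⟩ := Jimm.irrational_J_and_hasFrequency_P_J h1 hs hne
  refine ⟨h2, h3, hJ, hP, fun i hi => ?_⟩
  obtain ⟨r, rfl⟩ := Nat.exists_eq_add_of_le' hi
  rw [Jimm.u, hsum.tsum_eq]
  exact hfreq r _ (h3 r)
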